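/- Let $\mathcal A=\{u+\sigma v : u,v\in\mathbb R\}$, $\sigma^2=1$, be the algebra of Lorentz numbers, with $\widehat{u+\sigma v}=u-\sigma v$ and $|a|^2=a\widehat a=u^2-v^2\in\mathbb R$ for $a=u+\sigma v$. Put $\partial_a=\frac12(\partial_u+\sigma\partial_v)$, $\partial_{\widehat a}=\frac12(\partial_u-\sigma\partial_v)$, $da=du+\sigma dv$, $d\widehat a=du-\sigma dv$, so that $da\,d\widehat a=du^2-dv^2$. Let $\mathbb R^{2,2}$ be $\mathbb R^4$ with the metric $-dx_0^2+dx_1^2-dx_2^2+dx_3^2$. For an immersed surface with nondegenerate induced metric $g$ and second fundamental form $B$, the mean curvature vector is $\vec H=\frac12\mathrm{tr}_g B$, and $|\vec H|^2=\langle\vec H,\vec H\rangle$. For an open set $V\subset\mathcal A$, consider smooth functions $\phi_1,\phi_2,\psi_1,\psi_2:V\to\mathcal A$ and $p,q:V\to\mathbb R$ with $$\partial_a\phi_\alpha=-p\,\psi_\alpha,\qquad \partial_{\widehat a}\psi_\alpha=-q\,\phi_\alpha\quad(\alpha=1,2),\qquad |\psi_2\phi_1-\psi_1\phi_2|^2\neq0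 \text{ everywhere},\tag{1}$$ and, for a map $F=(F_0,F_1,F_2,F_3)$ on $V$ and a base point $a_0\in V$, the formulas (in which $F$ stands for $F-F(a_0)$) $$F_0+F_1=-\int_\gamma\big(\psi_1\widehat\phi_1\,da+\widehat\psi_1\phi_1\,d\widehat a\big),\qquad F_0-F_1=\int_\gamma\big(\psi_2\widehat\phi_2\,da+\widehat\psi_2\phi_2\,d\widehat a\big),$$ $$F_2+\sigma F_3=\int_\gamma\big(\psi_1\widehat\phi_2\,da+\widehat\psi_2\phi_1\,d\widehat a\big),\qquad F_2-\sigma F_3=\int_\gamma\big(\psi_2\widehat\phi_1\,da+\widehat\psi_1\phi_2\,d\widehat a\big),\tag{2}$$ for every piecewise $C^1$ path $\gamma$ in $V$ from $a_0$ to the variable point. **Direct statement.** Let (1) hold on $V=\mathcal A$. For every base point $a_0$ and every prescribed value $F(a_0)\in\mathbb R^{2,2}$ there is exactly one map $F:\mathcal A\to\mathbb R^{2,2}$ satisfying (2) (in particular the integrals do not depend on the path). It is a smooth conformal immersion, with induced metric $$g=-|\psi_2\phi_1-\psi_1\phi_2|^2\,da\,d\widehat a\tag{3}$$ and mean curvature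 vector satisfying $$|\vec H|^2=\frac{4pq}{|\psi_2\phi_1-\psi_1\phi_2|^2}.\tag{4}$$ **Converse.** Let $(M,g)$ be a smooth simply-connected Lorentzian surface and $F:M\to\mathbb R^{2,2}$ a smooth isometric immersion. A conformal chart of $M$ is a smooth chart $a=u+\sigma v:U\subset M\to\mathcal A$ in which $g=-\rho\,da\,d\widehat a$ with a nowhere vanishing function $\rho$; call its image null-convex if it is connected and meets each null line $u\pm v=\mathrm{const}$ in a connected (possibly empty) set; convex images, and the whole of $\mathcal A$, are examples. Every point of $M$ lies in the domain of a conformal chart with null-convex image and $\rho>0$. For every conformal chart with null-convex image $V$ there are functions $\phi_1,\phi_2,\psi_1,\psi_2,p,q$ on $V$ satisfying (1), such that $\rho=|\psi_2\phi_1-\psi_1\phi_2|^2$ and such that the map $F\circ a^{-1}:V\to\mathbb R^{2,2}$ is given by (2) for every base point in $V$, and is a smooth immersion with (3) and (4). -/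

import Mathlib

open scoped ContDiff Manifold

noncomputable section

/-- The real algebra of Lorentz numbers `u + σ v` with `σ ^ 2 = 1`. The conjugation
`u + σ v ↦ u - σ v` is `star`, and `|a|² = a * star a` is the real number
`QuadraticAlgebra.norm a`. -/
abbrev LorentzNumber : Type := QuadraticAlgebra ℝ 1 0

namespace LorentzNumber

/-- The real coordinates `(u, v)` of `u + σ v`. -/
def toProd : LorentzNumber →ₗ[ℝ] ℝ × ℝ :=
  LinearMap.prod (QuadraticAlgebra.reₗ (1 : ℝ) 0) (QuadraticAlgebra.imₗ (1 : ℝ) 0)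

theorem toProd_injective : Function.Injective toProd := by
  intro x y h
  have h' : (x.re, x.im) = (y.re, y.im) := h
  exact QuadraticAlgebra.ext (congrArg Prod.fst h') (congrArg Prod.snd h')

/-- The Lorentz numbers carry the topology of the plane (through a vector space norm, whose
choice is irrelevant). -/
instance : NormedAddCommGroup LorentzNumber :=
  NormedAddCommGroup.induced LorentzNumber (ℝ × ℝ) toProd.toAddMonoidHom toProd_injective

instance : NormedSpace ℝ LorentzNumber :=
  NormedSpace.induced ℝ LorentzNumber (ℝ × ℝ) toProd

/-- The unit `σ`. -/
def sigma : LorentzNumber := ⟨0, 1⟩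

/-- `∂_a = (∂_u + σ ∂_v) / 2`. -/
def partialA (f : LorentzNumber → LorentzNumber) (z : LorentzNumber) : LorentzNumber :=
  (1 / 2 : ℝ) • (fderiv ℝ f z 1 + sigma * fderiv ℝ f z sigma)

/-- `∂_â = (∂_u - σ ∂_v) / 2`. -/
def partialAHat (f : LorentzNumber → LorentzNumber) (z : LorentzNumber) : LorentzNumber :=
  (1 / 2 : ℝ) • (fderiv ℝ f z 1 - sigma * fderiv ℝ f z sigma)

/-- The value at a point of the `1`-form `P da + Q dâ`: the real linear map
`X ↦ P * X + Q * star X`. -/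
def formDa (P Q : LorentzNumber) : LorentzNumber →L[ℝ] LorentzNumber :=
  LinearMap.toContinuousLinearMap
    { toFun := fun X => P * X + Q * star X
      map_add' := fun X Y => by rw [star_add]; ring
      map_smul' := fun c X => by
        ext <;> simp <;> ring }

/-- The quadratic form `da dâ = du² - dv²`, polarized. -/
def daDaHat (X Y : LorentzNumber) : ℝ := (X * star Y).re

/-- `γ` is continuous and continuously differentiable on each interval of a finite partition
of `[0, 1]`. -/
def PiecewiseC1 {x y : LorentzNumber} (γ : Path x y) : Prop :=
  ∃ (n : ℕ) (t : Fin (n + 1) → ℝ), StrictMono t ∧ t 0 = 0 ∧ t (Fin.last n) = 1 ∧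
    ∀ i : Fin n, ContDiffOn ℝ 1 γ.extend (Set.Icc (t i.castSucc) (t i.succ))

/-- `V` is connected and meets each of the null lines `u + v = c` and `u - v = c` in a
connected (possibly empty) set. -/
structure NullConvex (V : Set LorentzNumber) : Prop where
  isPreconnected : IsPreconnected V
  null_add : ∀ c : ℝ, IsPreconnected {z ∈ V | z.re + z.im = c}
  null_sub : ∀ c : ℝ, IsPreconnected {z ∈ V | z.re - z.im = c}

end LorentzNumber

/-- The underlying vector space of `ℝ^{2,2}`. -/
abbrev R22 : Type := Fin 4 → ℝ

namespace R22

open LorentzNumber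

/-- The metric `-dx₀² + dx₁² - dx₂² + dx₃²`. -/
def ip (x y : R22) : ℝ := -(x 0 * y 0) + x 1 * y 1 - x 2 * y 2 + x 3 * y 3

/-- The coordinate vectors `∂_u`, `∂_v`. -/
def coordVec : Fin 2 → LorentzNumber := ![1, sigma]

/-- The tangent vectors `∂_u F`, `∂_v F` of a parameterized surface. -/
def tangentVec (F : LorentzNumber → R22) (z : LorentzNumber) (i : Fin 2) : R22 :=
  fderiv ℝ F z (coordVec i)

/-- The matrix `g_ij` of the induced metric. -/
def gram (F : LorentzNumber → R22) (z : LorentzNumber) : Matrix (Fin 2) (Fin 2) ℝ :=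
  Matrix.of fun i j => ip (tangentVec F z i) (tangentVec F z j)

/-- The component of `w` orthogonal to the tangent plane at `z` (where the induced metric is
nondegenerate). -/
def normalPart (F : LorentzNumber → R22) (z : LorentzNumber) (w : R22) : R22 :=
  w - ∑ i, ∑ j, ((gram F z)⁻¹ i j * ip w (tangentVec F z i)) • tangentVec F z j

/-- The second fundamental form `B(∂_i, ∂_j) = (∂_i ∂_j F)^⊥`. -/
def secondFF (F : LorentzNumber → R22) (z : LorentzNumber) (i j : Fin 2) : R22 :=
  normalPart F z (fderiv ℝ (fun w => tangentVec F w j) z (coordVec i))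

/-- The mean curvature vector `(1/2) tr_g B`. -/
def meanCurvature (F : LorentzNumber → R22) (z : LorentzNumber) : R22 :=
  (1 / 2 : ℝ) • ∑ i, ∑ j, (gram F z)⁻¹ i j • secondFF F z i j

end R22

namespace Weierstrass

open LorentzNumber

/-- The real function `|ψ₂ φ₁ - ψ₁ φ₂|²`. -/
def density (φ₁ φ₂ ψ₁ ψ₂ : LorentzNumber → LorentzNumber) (z : LorentzNumber) : ℝ :=
  QuadraticAlgebra.norm (ψ₂ z * φ₁ z - ψ₁ z * φ₂ z)

/-- Smooth functions on `V` solving the Dirac-type system, with `|ψ₂ φ₁ - ψ₁ φ₂|² ≠ 0`. -/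
structure IsData (V : Set LorentzNumber) (φ₁ φ₂ ψ₁ ψ₂ : LorentzNumber → LorentzNumber)
    (p q : LorentzNumber → ℝ) : Prop where
  smooth_φ₁ : ContDiffOn ℝ ∞ φ₁ V
  smooth_φ₂ : ContDiffOn ℝ ∞ φ₂ V
  smooth_ψ₁ : ContDiffOn ℝ ∞ ψ₁ V
  smooth_ψ₂ : ContDiffOn ℝ ∞ ψ₂ V
  smooth_p : ContDiffOn ℝ ∞ p V
  smooth_q : ContDiffOn ℝ ∞ q V
  dirac_φ₁ : ∀ z ∈ V, partialA φ₁ z = -(p z • ψ₁ z)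
  dirac_φ₂ : ∀ z ∈ V, partialA φ₂ z = -(p z • ψ₂ z)
  dirac_ψ₁ : ∀ z ∈ V, partialAHat ψ₁ z = -(q z • φ₁ z)
  dirac_ψ₂ : ∀ z ∈ V, partialAHat ψ₂ z = -(q z • φ₂ z)
  density_ne_zero : ∀ z ∈ V, density φ₁ φ₂ ψ₁ ψ₂ z ≠ 0

/-- `F - F z₀` is given on `V` by the integral formulas, along every piecewise `C¹` path in `V`
from `z₀` to a variable point. -/
def IsIntegral (V : Set LorentzNumber) (z₀ : LorentzNumber)
    (φ₁ φ₂ ψ₁ ψ₂ : LorentzNumber → LorentzNumber) (F : LorentzNumber → R22) : Prop :=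
  ∀ (z : LorentzNumber) (γ : Path z₀ z), PiecewiseC1 γ → (∀ t, γ t ∈ V) →
    algebraMap ℝ LorentzNumber ((F z - F z₀) 0) + algebraMap ℝ LorentzNumber ((F z - F z₀) 1) =
      -curveIntegral (fun w => formDa (ψ₁ w * star (φ₁ w)) (star (ψ₁ w) * φ₁ w)) γ ∧
    algebraMap ℝ LorentzNumber ((F z - F z₀) 0) - algebraMap ℝ LorentzNumber ((F z - F z₀) 1) =
      curveIntegral (fun w => formDa (ψ₂ w * star (φ₂ w)) (star (ψ₂ w) * φ₂ w)) γ ∧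
    algebraMap ℝ LorentzNumber ((F z - F z₀) 2) +
        sigma * algebraMap ℝ LorentzNumber ((F z - F z₀) 3) =
      curveIntegral (fun w => formDa (ψ₁ w * star (φ₂ w)) (star (ψ₂ w) * φ₁ w)) γ ∧
    algebraMap ℝ LorentzNumber ((F z - F z₀) 2) -
        sigma * algebraMap ℝ LorentzNumber ((F z - F z₀) 3) =
      curveIntegral (fun w => formDa (ψ₂ w * star (φ₁ w)) (star (ψ₁ w) * φ₂ w)) γ

/-- `F` is a smooth conformal immersion on `V`, with induced metric
`-|ψ₂ φ₁ - ψ₁ φ₂|² da dâ` and with mean curvature vector of squared Lorentzian norm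
`4 p q / |ψ₂ φ₁ - ψ₁ φ₂|²`. -/
structure HasGeometry (V : Set LorentzNumber)
    (φ₁ φ₂ ψ₁ ψ₂ : LorentzNumber → LorentzNumber) (p q : LorentzNumber → ℝ)
    (F : LorentzNumber → R22) : Prop where
  smooth : ContDiffOn ℝ ∞ F V
  immersion : ∀ z ∈ V, Function.Injective (fderiv ℝ F z)
  metric : ∀ z ∈ V, ∀ X Y : LorentzNumber,
    R22.ip (fderiv ℝ F z X) (fderiv ℝ F z Y) = -density φ₁ φ₂ ψ₁ ψ₂ z * daDaHat X Y
  curvature : ∀ z ∈ V, R22.ip (R22.meanCurvature F z) (R22.meanCurvature F z) =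
    4 * (p z * q z) / density φ₁ φ₂ ψ₁ ψ₂ z

end Weierstrass

section Surface

variable (M : Type*) [TopologicalSpace M] [ChartedSpace (EuclideanSpace ℝ (Fin 2)) M]

/-- A smooth Lorentzian metric (signature `(1, 1)`) on a smooth surface. -/
structure LorentzianMetric [IsManifold (𝓡 2) ∞ M] where
  inner (x : M) : TangentSpace (𝓡 2) x →L[ℝ] TangentSpace (𝓡 2) x →L[ℝ] ℝ
  symm (x : M) (v w : TangentSpace (𝓡 2) x) : inner x v w = inner x w v
  signature (x : M) : ∃ v w : TangentSpace (𝓡 2) x,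
    inner x v v = -1 ∧ inner x w w = 1 ∧ inner x v w = 0
  contMDiff : ContMDiff (𝓡 2)
    ((𝓡 2).prod 𝓘(ℝ, EuclideanSpace ℝ (Fin 2) →L[ℝ] EuclideanSpace ℝ (Fin 2) →L[ℝ] ℝ)) ∞
    (fun x => Bundle.TotalSpace.mk'
      (EuclideanSpace ℝ (Fin 2) →L[ℝ] EuclideanSpace ℝ (Fin 2) →L[ℝ] ℝ)
      (E := fun x : M => TangentSpace (𝓡 2) x →L[ℝ] TangentSpace (𝓡 2) x →L[ℝ] ℝ) x (inner x))

variable {M} [IsManifold (𝓡 2) ∞ M]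

/-- `F` is a smooth isometric immersion of `(M, g)` into `ℝ^{2,2}` (injectivity of the
differential follows, as `g` is nondegenerate). -/
structure IsIsometricImmersion (g : LorentzianMetric M) (F : M → R22) : Prop where
  smooth : ContMDiff (𝓡 2) 𝓘(ℝ, R22) ∞ F
  isometric : ∀ (x : M) (v w : TangentSpace (𝓡 2) x),
    R22.ip (mfderiv (𝓡 2) 𝓘(ℝ, R22) F x v) (mfderiv (𝓡 2) 𝓘(ℝ, R22) F x w) = g.inner x v w

/-- `a` is a smooth chart of `M` with values in the Lorentz numbers in which
`g = -ρ da dâ`, with a nowhere vanishing function `ρ`. -/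
structure IsConformalChart (g : LorentzianMetric M)
    (a : OpenPartialHomeomorph M LorentzNumber) (ρ : LorentzNumber → ℝ) : Prop where
  smooth : ContMDiffOn (𝓡 2) 𝓘(ℝ, LorentzNumber) ∞ a a.source
  smooth_symm : ContMDiffOn 𝓘(ℝ, LorentzNumber) (𝓡 2) ∞ a.symm a.target
  ne_zero : ∀ z ∈ a.target, ρ z ≠ 0
  conformal : ∀ z ∈ a.target, ∀ X Y : LorentzNumber,
    g.inner (a.symm z) (mfderiv 𝓘(ℝ, LorentzNumber) (𝓡 2) a.symm z X)
      (mfderiv 𝓘(ℝ, LorentzNumber) (𝓡 2) a.symm z Y) = -ρ z * LorentzNumber.daDaHat X Y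

end Surface

end

/-!
In the null coordinates `s = u + v`, `t = u - v` the Lorentz numbers become `ℝ × ℝ` with
componentwise operations. Let `A`, `B` be the first null components of the pairs `(ψ₁, ψ₂)`,
`(φ₁, φ₂)`, and `E`, `C` the second ones; these are spinors with values in `ℝ²`. The Dirac system
says `A_t = -q B`, `B_s = -p A`, `C_t = -p E`, `E_s = -q C`. Identify `ℝ^{2,2}` with
`ℝ² ⊗ ℝ²` so that its metric is half the product of the area forms (`R22.tmul`, `R22.ip_tmul`).
Then the integral formulas say that `F_s = A ⊗ C` and `F_t = B ⊗ E`
(`Weierstrass.isIntegral_of_hasFDerivAt`).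

Direct statement. By the Dirac system both mixed derivatives are `-(q B ⊗ C + p A ⊗ E)`, so the
form is closed, and it has a primitive on the plane. The metric and the mean curvature, which is a
multiple of `F_{st}`, are computed with the area forms (`Weierstrass.hasGeometry_of_hasFDerivAt`).

Converse over a null convex set `V` (`Weierstrass.exists_data`). The null vectors `F_s`, `F_t` have
rank one, and they factor globally as `A ⊗ C`, `B ⊗ E` (`Weierstrass.exists_tmul_eq`): the line
spanned by the first factor is encoded by a nonzero complex function, which has a square root
because the Poincaré lemma holds on `V` (`exists_potential_of_slices`). The factors may be
rescaled to `exp l • A`, `exp (-l) • C`. Since `F_{st}` is orthogonal to `F_s` and `F_t`, a suitable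
`l`, found by integration along null lines, makes `A_t` a multiple of `B` and `C_t` one of `E`
(`Weierstrass.exists_balanced_rescaling`); likewise for `B_s` and `E_s`. Equality of the mixed
derivatives leaves only two independent coefficients, which are `-p` and `-q`. Connectedness of
the null slices enters through the existence of a smooth section of each of the two projections
(`exists_contDiffOn_section`).

Existence of conformal charts. The two null directions of the metric are spanned by `(1, h)` and
`(k, 1)` with smooth `h`, `k`. Functions constant along the integral curves of these fields
(`exists_characteristic_coordinate`, from a smooth dependence theorem for flows) are null
coordinates, and a square with null sides is null convex (`exists_null_coordinates`).
-/

section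

open Set Filter Topology

/-! ### Parameter integrals and smooth sections -/

/-- An integral over `[0, 1]` depends smoothly on parameters as soon as the integrand is smooth near
`V ×ˢ [0, 1]`. Near a given parameter the integrand may be multiplied by a bump function equal to
`1` on `[0, 1]`; the integral is then the value at `0` of the convolution with the indicator of
`(0, 1]`, and the smoothness of convolutions with parameters applies. -/
theorem contDiffOn_intervalIntegral {E G : Type*} [NormedAddCommGroup E] [NormedSpace ℝ E]
    [NormedAddCommGroup G] [NormedSpace ℝ G] {n : ℕ∞} {V : Set E}
    {U : Set (E × ℝ)} (hU : IsOpen U) (hV : ∀ z ∈ V, ∀ x ∈ Icc (0 : ℝ) 1, (z, x) ∈ U)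
    {g : E × ℝ → G} (hg : ContDiffOn ℝ n g U) :
    ContDiffOn ℝ n (fun z => ∫ x in (0 : ℝ)..1, g (z, x)) V := by
  intro z₀ hz₀
  obtain ⟨N, I, hN, hI, hzN, hIcc, hNI⟩ := generalized_tube_lemma (s := {z₀}) isCompact_singleton
    (t := Icc (0 : ℝ) 1) isCompact_Icc hU (by
      rintro ⟨a, b⟩ ⟨ha, hb⟩
      obtain rfl : a = z₀ := ha
      exact hV _ hz₀ b hb)
  obtain ⟨δ, hδ, hδI⟩ := isCompact_Icc.exists_cthickening_subset_open hI hIcc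
  have hball : Icc (0 : ℝ) 1 = Metric.closedBall (1 / 2) (1 / 2) := by
    rw [Real.closedBall_eq_Icc]; norm_num
  rw [hball, cthickening_closedBall hδ.le (by norm_num)] at hδI
  let χ : ContDiffBump (1 / 2 : ℝ) := ⟨1 / 2, 1 / 2 + δ, by norm_num, by linarith⟩
  have hχI : tsupport χ ⊆ I := by
    rw [χ.tsupport_eq]; rw [add_comm] at hδI; exact hδI
  -- The convolution evaluates its right factor at `0 - x`, whence the sign.
  let g' : E → ℝ → G := fun z x => χ (-x) • g (z, -x)
  have hk : IsCompact (Neg.neg '' tsupport χ) :=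
    (χ.hasCompactSupport.isCompact).image continuous_neg
  have hsupp : ∀ p, ∀ x, p ∈ N → x ∉ Neg.neg '' tsupport χ → g' p x = 0 := by
    intro p x _ hx
    have : -x ∉ tsupport χ := fun h => hx ⟨-x, h, neg_neg x⟩
    simp [g', image_eq_zero_of_notMem_tsupport this]
  have hsm : ContDiffOn ℝ n (Function.uncurry g') (N ×ˢ univ) := by
    rintro ⟨p, x⟩ ⟨hp, -⟩
    apply ContDiffAt.contDiffWithinAt
    by_cases hx : -x ∈ tsupport χ
    · have h1 : ContDiffAt ℝ n g (p, -x) :=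
        hg.contDiffAt (hU.mem_nhds (hNI ⟨hp, hχI hx⟩))
      have h2 : ContDiffAt ℝ n (fun y : E × ℝ => (y.1, -y.2)) (p, x) := by fun_prop
      have h3 : ContDiffAt ℝ n (fun y : E × ℝ => χ (-y.2)) (p, x) :=
        χ.contDiff.contDiffAt.comp (p, x) (by fun_prop : ContDiffAt ℝ n (fun y : E × ℝ => -y.2) _)
      exact h3.smul (ContDiffAt.comp (p, x) h1 h2)
    · have : ∀ᶠ y : E × ℝ in 𝓝 (p, x), -y.2 ∈ (tsupport χ)ᶜ :=
        (continuous_snd.neg.continuousAt).eventually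
          ((isClosed_tsupport χ).isOpen_compl.mem_nhds hx)
      refine (contDiffAt_const (c := (0 : G))).congr_of_eventuallyEq ?_
      filter_upwards [this] with y hy
      simp [Function.uncurry, g', image_eq_zero_of_notMem_tsupport hy]
  have hloc : MeasureTheory.LocallyIntegrable ((Ioc (0 : ℝ) 1).indicator fun _ => (1 : ℝ)) := by
    apply MeasureTheory.Integrable.locallyIntegrable
    rw [MeasureTheory.integrable_indicator_iff measurableSet_Ioc]
    simp
  have key := MeasureTheory.contDiffOn_convolution_right_with_param_comp (μ := MeasureTheory.volume)
    (ContinuousLinearMap.lsmul ℝ ℝ : ℝ →L[ℝ] G →L[ℝ] G)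
    (v := fun _ : E => (0 : ℝ)) contDiffOn_const hN hk hsupp hloc hsm
  refine ((key.contDiffAt (hN.mem_nhds (hzN rfl))).congr_of_eventuallyEq ?_).contDiffWithinAt
  refine Eventually.of_forall fun z => ?_
  beta_reduce
  rw [intervalIntegral.integral_of_le zero_le_one,
    ← MeasureTheory.integral_indicator measurableSet_Ioc]
  unfold MeasureTheory.convolution
  congr 1
  ext t
  by_cases ht : t ∈ Ioc (0 : ℝ) 1
  · have : χ t = 1 := χ.one_of_mem_closedBall (by
      rw [show χ.rIn = 1 / 2 from rfl, ← hball]; exact Ioc_subset_Icc_self ht)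
    simp [ht, g', this]
  · simp [ht]

/-- An open set of the plane with connected vertical slices contains the graph of a smooth function
over its shadow: local constant choices are averaged by a partition of unity, which is possible as
the slices are convex. -/
theorem exists_contDiffOn_section {V : Set (ℝ × ℝ)} (hV : IsOpen V)
    (hslice : ∀ s, IsPreconnected {t | (s, t) ∈ V}) :
    ∃ τ : ℝ → ℝ, ContDiffOn ℝ ∞ τ (Prod.fst '' V) ∧ ∀ s ∈ Prod.fst '' V, (s, τ s) ∈ V := by
  classical
  let I : TopologicalSpace.Opens ℝ := ⟨Prod.fst '' V, isOpenMap_fst V hV⟩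
  have : LocallyCompactSpace I := I.isOpen.locallyCompactSpace
  have : SigmaCompactSpace I := sigmaCompactSpace_of_locallyCompact_secondCountable
  obtain ⟨g, hg⟩ := exists_contMDiffMap_forall_mem_convex_of_local_const (n := ⊤) 𝓘(ℝ, ℝ)
    (M := I) (t := fun s => {t | (s.1, t) ∈ V})
    (fun s => (hslice s).ordConnected.convex) (by
      rintro ⟨s, ⟨⟨s', t⟩, hst, rfl⟩⟩
      refine ⟨t, ?_⟩
      have : ContinuousAt (fun y : I => (y.1, t)) ⟨s', ⟨(s', t), hst, rfl⟩⟩ := by fun_prop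
      exact this.eventually (hV.mem_nhds hst))
  let τ : ℝ → ℝ := fun s => if h : s ∈ I then g ⟨s, h⟩ else 0
  have hτ : ∀ s : I, τ s = g s := fun s => by simp [τ]
  refine ⟨τ, fun s hs => ?_, fun s hs => ?_⟩
  · have h1 : ContMDiffAt 𝓘(ℝ, ℝ) 𝓘(ℝ, ℝ) ∞ (fun x : I => τ x) ⟨s, hs⟩ := by
      have : (fun x : I => τ x) = g := funext hτ
      rw [this]; exact g.contMDiff.contMDiffAt
    exact (contMDiffAt_subtype_iff.1 h1).contDiffAt.contDiffWithinAt
  · have := hg ⟨s, hs⟩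
    rw [← hτ] at this
    exact this

/-! ### Primitives and potentials on open sets of the plane -/

section Directional
variable {E G : Type*} [NormedAddCommGroup E] [NormedSpace ℝ E] [NormedAddCommGroup G]
  [NormedSpace ℝ G] {V : Set E} {f : E → G}

theorem ContDiffOn.fderiv_apply_const (hf : ContDiffOn ℝ ∞ f V) (hV : IsOpen V) (v : E) :
    ContDiffOn ℝ ∞ (fun w => fderiv ℝ f w v) V :=
  ((contDiffOn_infty_iff_fderiv_of_isOpen hV).1 hf).2.clm_apply contDiffOn_const

theorem ContDiffOn.fderiv_fderiv_apply (hf : ContDiffOn ℝ ∞ f V) (hV : IsOpen V) {z : E}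
    (hz : z ∈ V) (u v : E) :
    fderiv ℝ (fun w => fderiv ℝ f w u) z v = fderiv ℝ (fderiv ℝ f) z v u := by
  have h := ((contDiffOn_infty_iff_fderiv_of_isOpen hV).1 hf).2
  have h' : DifferentiableAt ℝ (fderiv ℝ f) z :=
    (h.contDiffAt (hV.mem_nhds hz)).differentiableAt (by simp)
  rw [fderiv_clm_apply h' (differentiableAt_const u)]
  simp

/-- The symmetry of second derivatives, for directional derivatives. -/
theorem ContDiffOn.fderiv_apply_comm (hf : ContDiffOn ℝ ∞ f V) (hV : IsOpen V) {z : E}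
    (hz : z ∈ V) (u v : E) :
    fderiv ℝ (fun w => fderiv ℝ f w u) z v = fderiv ℝ (fun w => fderiv ℝ f w v) z u := by
  rw [hf.fderiv_fderiv_apply hV hz, hf.fderiv_fderiv_apply hV hz]
  exact (hf.contDiffAt (hV.mem_nhds hz)).isSymmSndFDerivAt
    (by rw [minSmoothness_of_isRCLikeNormedField]; exact WithTop.coe_le_coe.2 le_top) v u

theorem ContDiffOn.hasFDerivAt (hf : ContDiffOn ℝ ∞ f V) (hV : IsOpen V) {z : E}
    (hz : z ∈ V) : HasFDerivAt f (fderiv ℝ f z) z :=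
  ((hf.contDiffAt (hV.mem_nhds hz)).differentiableAt (by simp)).hasFDerivAt

end Directional

section Primitives
variable {G : Type*} [NormedAddCommGroup G] [NormedSpace ℝ G] [CompleteSpace G]

/-- A smooth function on an open set with connected vertical slices has a smooth vertical primitive,
namely the integral along each slice from the point of a smooth section. -/
theorem exists_vertical_primitive {V : Set (ℝ × ℝ)} (hV : IsOpen V)
    (hslice : ∀ s, IsPreconnected {t | (s, t) ∈ V}) {α : ℝ × ℝ → G} (hα : ContDiffOn ℝ ∞ α V) :
    ∃ l : ℝ × ℝ → G, ContDiffOn ℝ ∞ l V ∧ ∀ z ∈ V, fderiv ℝ l z (0, 1) = α z := by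
  obtain ⟨τ, hτ, hτV⟩ := exists_contDiffOn_section hV hslice
  -- The segment from the section to a point, parameterized by `[0, 1]`.
  let m : (ℝ × ℝ) × ℝ → ℝ × ℝ := fun y => (y.1.1, τ y.1.1 + (y.1.2 - τ y.1.1) * y.2)
  have hm : ContDiffOn ℝ ∞ m (V ×ˢ univ) := by
    have h1 : ContDiffOn ℝ ∞ (fun y : (ℝ × ℝ) × ℝ => τ y.1.1) (V ×ˢ univ) :=
      hτ.comp (by fun_prop) fun y hy => ⟨y.1, hy.1, rfl⟩
    exact ContDiffOn.prodMk (by fun_prop) (h1.add (ContDiffOn.mul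
      (ContDiffOn.sub (by fun_prop) h1) (by fun_prop)))
  have hU : IsOpen ((V ×ˢ univ) ∩ m ⁻¹' V) :=
    hm.continuousOn.isOpen_inter_preimage (hV.prod isOpen_univ) hV
  have hint := contDiffOn_intervalIntegral (n := ⊤) (V := V) (g := fun y => α (m y)) hU
    (by
      intro z hz x hx
      refine ⟨⟨hz, mem_univ _⟩, ?_⟩
      have hc : Convex ℝ {t | (z.1, t) ∈ V} := (hslice z.1).ordConnected.convex
      have h := hc (hτV z.1 ⟨z, hz, rfl⟩) (show z.2 ∈ {t | (z.1, t) ∈ V} from hz)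
        (sub_nonneg.2 hx.2) hx.1 (by ring)
      simp only [smul_eq_mul, mem_ofPred_eq] at h
      have e : τ z.1 + (z.2 - τ z.1) * x = (1 - x) * τ z.1 + x * z.2 := by ring
      show (z.1, τ z.1 + (z.2 - τ z.1) * x) ∈ V
      rw [e]
      exact h)
    (hα.comp (hm.mono inter_subset_left) fun y hy => hy.2)
  let l : ℝ × ℝ → G := fun z => (z.2 - τ z.1) •
    ∫ x in (0 : ℝ)..1, α (z.1, τ z.1 + (z.2 - τ z.1) * x)
  have hl : ContDiffOn ℝ ∞ l V := by
    have h1 : ContDiffOn ℝ ∞ (fun y : ℝ × ℝ => τ y.1) V :=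
      hτ.comp (by fun_prop) fun y hy => ⟨y, hy, rfl⟩
    exact ContDiffOn.smul (ContDiffOn.sub (by fun_prop) h1) hint
  refine ⟨l, hl, ?_⟩
  rintro ⟨s, t⟩ hz
  have hl' : ∀ t, l (s, t) = ∫ r in (τ s)..t, α (s, r) := by
    intro t
    simp only [l]
    rw [intervalIntegral.smul_integral_comp_add_mul (fun r => α (s, r))]
    congr 1 <;> ring
  have hsl : IsOpen {t | (s, t) ∈ V} := hV.preimage (by fun_prop : Continuous fun t => (s, t))
  have hcont : ContinuousOn (fun r => α (s, r)) {t | (s, t) ∈ V} :=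
    hα.continuousOn.comp (by fun_prop) fun r hr => hr
  have hsub : uIcc (τ s) t ⊆ {t | (s, t) ∈ V} :=
    (hslice s).ordConnected.uIcc_subset (hτV s ⟨_, hz, rfl⟩) hz
  have hd : HasDerivAt (fun t => ∫ r in (τ s)..t, α (s, r)) (α (s, t)) t :=
    intervalIntegral.integral_hasDerivAt_right (hcont.mono hsub).intervalIntegrable
      (hcont.stronglyMeasurableAtFilter hsl t hz) (hcont.continuousAt (hsl.mem_nhds hz))
  have hd2 : HasDerivAt (fun t => l (s, t)) (fderiv ℝ l (s, t) (0, 1)) t := by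
    have h2 : HasDerivAt (fun t : ℝ => (s, t)) (0, 1) t :=
      (hasDerivAt_const t s).prodMk (hasDerivAt_id t)
    exact (hl.hasFDerivAt hV hz).comp_hasDerivAt t h2
  simp only [hl'] at hd2
  exact hd2.unique hd

/-- The Poincaré lemma for an open connected set with connected vertical slices: a vertical
primitive of `η₂` is corrected by a function of the first coordinate alone. -/
theorem exists_potential_prod {V : Set (ℝ × ℝ)} (hV : IsOpen V)
    (hslice : ∀ s, IsPreconnected {t | (s, t) ∈ V}) (hconn : IsPreconnected V)
    {η₁ η₂ : ℝ × ℝ → G} (hη₁ : ContDiffOn ℝ ∞ η₁ V) (hη₂ : ContDiffOn ℝ ∞ η₂ V)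
    (hclosed : ∀ z ∈ V, fderiv ℝ η₁ z (0, 1) = fderiv ℝ η₂ z (1, 0)) :
    ∃ θ : ℝ × ℝ → G, ContDiffOn ℝ ∞ θ V ∧
      ∀ z ∈ V, fderiv ℝ θ z (1, 0) = η₁ z ∧ fderiv ℝ θ z (0, 1) = η₂ z := by
  obtain ⟨τ, hτ, hτV⟩ := exists_contDiffOn_section hV hslice
  obtain ⟨l, hl, hl2⟩ := exists_vertical_primitive hV hslice hη₂
  -- The defect in the first component, which is constant along vertical slices.
  let h : ℝ × ℝ → G := fun z => η₁ z - fderiv ℝ l z (1, 0)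
  have hl1 := hl.fderiv_apply_const hV (1, 0)
  have hh : ContDiffOn ℝ ∞ h V := hη₁.sub hl1
  have hh0 : ∀ z ∈ V, fderiv ℝ h z (0, 1) = 0 := by
    intro z hz
    have e1 : fderiv ℝ h z = fderiv ℝ η₁ z - fderiv ℝ (fun w => fderiv ℝ l w (1, 0)) z :=
      ((hη₁.hasFDerivAt hV hz).sub (hl1.hasFDerivAt hV hz)).fderiv
    have e2 : fderiv ℝ (fun w => fderiv ℝ l w (0, 1)) z = fderiv ℝ η₂ z :=
      Filter.EventuallyEq.fderiv_eq (by filter_upwards [hV.mem_nhds hz] with w hw using hl2 w hw)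
    rw [e1, sub_apply, hl.fderiv_apply_comm hV hz, e2, hclosed z hz, sub_self]
  have hconst : ∀ s t t', (s, t) ∈ V → (s, t') ∈ V → h (s, t) = h (s, t') := by
    intro s t t' ht ht'
    have hsl : IsOpen {t | (s, t) ∈ V} := hV.preimage (by fun_prop : Continuous fun t => (s, t))
    have hd : ∀ t, (s, t) ∈ V → HasDerivAt (fun t => h (s, t)) 0 t := by
      intro t ht
      have h2 : HasDerivAt (fun t : ℝ => (s, t)) (0, 1) t :=
        (hasDerivAt_const t s).prodMk (hasDerivAt_id t)
      have := (hh.hasFDerivAt hV ht).comp_hasDerivAt t h2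
      rwa [hh0 _ ht] at this
    exact hsl.is_const_of_deriv_eq_zero (hslice s)
      (fun t ht => (hd t ht).differentiableAt.differentiableWithinAt)
      (fun t ht => (hd t ht).deriv) ht ht'
  have hI : IsOpen (Prod.fst '' V) := isOpenMap_fst V hV
  have hk : ContDiffOn ℝ ∞ (fun s => h (s, τ s)) (Prod.fst '' V) :=
    hh.comp (contDiffOn_id.prodMk hτ) fun s hs => hτV s hs
  -- The shadow of `V` is connected, so that a function of the first coordinate has a primitive.
  obtain ⟨k, hksm, hk'⟩ := exists_vertical_primitive (V := univ ×ˢ (Prod.fst '' V))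
    (isOpen_univ.prod hI)
    (fun s => by
      convert hconn.image Prod.fst continuous_fst.continuousOn using 1
      ext t; simp)
    (hk.comp (contDiffOn_snd (s := univ ×ˢ (Prod.fst '' V))) fun z hz => hz.2)
  let K : ℝ × ℝ → G := fun z => k (0, z.1)
  have hm : ∀ z ∈ V, ((0 : ℝ), z.1) ∈ univ ×ˢ (Prod.fst '' V) := fun z hz =>
    ⟨mem_univ _, z, hz, rfl⟩
  have hK : ContDiffOn ℝ ∞ K V := hksm.comp (by fun_prop) hm
  have hKd : ∀ z ∈ V, ∀ v : ℝ × ℝ, fderiv ℝ K z v = v.1 • h z := by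
    intro z hz v
    have e1 : HasFDerivAt K ((fderiv ℝ k (0, z.1)).comp
        ((0 : ℝ × ℝ →L[ℝ] ℝ).prod (ContinuousLinearMap.fst ℝ ℝ ℝ))) z :=
      (hksm.hasFDerivAt (isOpen_univ.prod hI) (hm z hz)).comp z
        ((hasFDerivAt_const (0 : ℝ) z).prodMk hasFDerivAt_fst)
    rw [e1.fderiv]
    have : ((0 : ℝ), v.1) = v.1 • ((0 : ℝ), (1 : ℝ)) := by simp
    simp only [ContinuousLinearMap.comp_apply, ContinuousLinearMap.prod_apply, zero_apply,
      ContinuousLinearMap.coe_fst']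
    rw [this, map_smul, hk' _ (hm z hz)]
    congr 1
    exact hconst _ _ _ (hτV _ ⟨z, hz, rfl⟩) hz
  refine ⟨fun z => l z + K z, hl.add hK, fun z hz => ?_⟩
  have e1 : fderiv ℝ (fun z => l z + K z) z = fderiv ℝ l z + fderiv ℝ K z :=
    ((hl.hasFDerivAt hV hz).add (hK.hasFDerivAt hV hz)).fderiv
  rw [e1, add_apply, add_apply, hKd z hz, hKd z hz, hl2 z hz]
  simp [h]

variable {E : Type*} [NormedAddCommGroup E] [NormedSpace ℝ E]

theorem isPreconnected_slice_image (e : E ≃L[ℝ] ℝ × ℝ) {V : Set E}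
    (hslice : ∀ s, IsPreconnected {z ∈ V | (e z).1 = s}) (s : ℝ) :
    IsPreconnected {t | (s, t) ∈ e.symm ⁻¹' V} := by
  convert (hslice s).image (fun z => (e z).2) (by fun_prop) using 1
  ext t
  constructor
  · intro h
    exact ⟨e.symm (s, t), ⟨h, by simp⟩, by simp⟩
  · rintro ⟨z, ⟨hz, rfl⟩, rfl⟩
    simpa using hz

/-- `exists_vertical_primitive` in the linear coordinates `e`. -/
theorem exists_primitive_of_slices (e : E ≃L[ℝ] ℝ × ℝ) {V : Set E} (hV : IsOpen V)
    (hslice : ∀ s, IsPreconnected {z ∈ V | (e z).1 = s}) {α : E → G} (hα : ContDiffOn ℝ ∞ α V) :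
    ∃ l : E → G, ContDiffOn ℝ ∞ l V ∧ ∀ z ∈ V, fderiv ℝ l z (e.symm (0, 1)) = α z := by
  obtain ⟨l, hl, hl'⟩ := exists_vertical_primitive (hV.preimage e.symm.continuous)
    (isPreconnected_slice_image e hslice)
    (hα.comp (e.symm.contDiff.contDiffOn (s := e.symm ⁻¹' V)) fun _ h => h)
  have hm : ∀ z ∈ V, e z ∈ e.symm ⁻¹' V := fun z hz => by simpa using hz
  refine ⟨l ∘ e, hl.comp e.contDiff.contDiffOn hm, fun z hz => ?_⟩
  rw [ContinuousLinearEquiv.comp_right_fderiv]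
  simp [hl' _ (hm z hz)]

/-- The Poincaré lemma `exists_potential_prod` in the linear coordinates `e`. -/
theorem exists_potential_of_slices (e : E ≃L[ℝ] ℝ × ℝ) {V : Set E} (hV : IsOpen V)
    (hslice : ∀ s, IsPreconnected {z ∈ V | (e z).1 = s}) (hconn : IsPreconnected V)
    {η₁ η₂ : E → G} (hη₁ : ContDiffOn ℝ ∞ η₁ V) (hη₂ : ContDiffOn ℝ ∞ η₂ V)
    (hclosed : ∀ z ∈ V, fderiv ℝ η₁ z (e.symm (0, 1)) = fderiv ℝ η₂ z (e.symm (1, 0))) :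
    ∃ θ : E → G, ContDiffOn ℝ ∞ θ V ∧ ∀ z ∈ V,
      fderiv ℝ θ z (e.symm (1, 0)) = η₁ z ∧ fderiv ℝ θ z (e.symm (0, 1)) = η₂ z := by
  have hs : ContDiffOn ℝ ∞ e.symm (e.symm ⁻¹' V) := e.symm.contDiff.contDiffOn
  have hpre : IsPreconnected (e.symm ⁻¹' V) := by
    rw [← e.image_eq_preimage_symm]; exact hconn.image e e.continuous.continuousOn
  obtain ⟨θ, hθ, hθ'⟩ := exists_potential_prod (hV.preimage e.symm.continuous)
    (isPreconnected_slice_image e hslice) hpre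
    (hη₁.comp hs fun _ h => h) (hη₂.comp hs fun _ h => h) (fun z hz => by
      rw [ContinuousLinearEquiv.comp_right_fderiv, ContinuousLinearEquiv.comp_right_fderiv]
      exact hclosed _ hz)
  have hm : ∀ z ∈ V, e z ∈ e.symm ⁻¹' V := fun z hz => by simpa using hz
  refine ⟨θ ∘ e, hθ.comp e.contDiff.contDiffOn hm, fun z hz => ?_⟩
  rw [ContinuousLinearEquiv.comp_right_fderiv]
  simpa using hθ' _ (hm z hz)

/-- A nowhere vanishing smooth complex function has a smooth logarithm: a potential `l` of the
closed form `dW / W` makes `exp (-l) * W` constant. -/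
theorem exists_smooth_log_of_slices (e : E ≃L[ℝ] ℝ × ℝ) {V : Set E} (hV : IsOpen V)
    (hslice : ∀ s, IsPreconnected {z ∈ V | (e z).1 = s}) (hconn : IsPreconnected V)
    {W : E → ℂ} (hW : ContDiffOn ℝ ∞ W V) (hW0 : ∀ z ∈ V, W z ≠ 0) :
    ∃ l : E → ℂ, ContDiffOn ℝ ∞ l V ∧ ∀ z ∈ V, Complex.exp (l z) = W z := by
  have hd : ∀ v, ContDiffOn ℝ ∞ (fun z => fderiv ℝ W z v / W z) V := fun v => by
    simp only [div_eq_mul_inv]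
    exact (hW.fderiv_apply_const hV v).mul (hW.inv hW0)
  have hdd : ∀ z ∈ V, ∀ u v, fderiv ℝ (fun z => fderiv ℝ W z v / W z) z u =
      (fderiv ℝ (fun z => fderiv ℝ W z v) z u * W z - fderiv ℝ W z v * fderiv ℝ W z u) /
        W z ^ 2 := by
    intro z hz u v
    have h1 := ((hW.fderiv_apply_const hV v).hasFDerivAt hV hz)
    have h2 := hW.hasFDerivAt hV hz
    have h3 : HasFDerivAt (fun w => (W w)⁻¹)
        ((-ContinuousLinearMap.mulLeftRight ℝ ℂ (W z)⁻¹ (W z)⁻¹).comp (fderiv ℝ W z)) z :=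
      (hasFDerivAt_inv' (hW0 z hz)).comp z h2
    simp only [div_eq_mul_inv]
    rw [(h1.fun_mul h3).fderiv]
    have := hW0 z hz
    simp
    field_simp
    ring
  obtain ⟨l, hl, hl'⟩ := exists_potential_of_slices e hV hslice hconn
    (hd (e.symm (1, 0))) (hd (e.symm (0, 1))) (fun z hz => by
      rw [hdd z hz, hdd z hz, hW.fderiv_apply_comm hV hz]; ring)
  have hld : ∀ z ∈ V, ∀ v, fderiv ℝ l z v = fderiv ℝ W z v / W z := by
    intro z hz v
    have hv : v = (e v).1 • e.symm (1, 0) + (e v).2 • e.symm (0, 1) := by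
      apply e.injective; ext <;> simp
    rw [hv]
    simp only [map_add, map_smul, hl' z hz]
    simp only [Complex.real_smul]; ring
  have hq : DifferentiableOn ℝ (fun z => Complex.exp (-l z) * W z) V := fun z hz =>
    (((hl.hasFDerivAt hV hz).fun_neg.cexp).fun_mul
      (hW.hasFDerivAt hV hz)).differentiableAt.differentiableWithinAt
  obtain ⟨c, hc⟩ := hV.exists_is_const_of_fderiv_eq_zero hconn hq (fun z hz => by
    rw [(((hl.hasFDerivAt hV hz).fun_neg.cexp).fun_mul (hW.hasFDerivAt hV hz)).fderiv]
    ext v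
    have := hW0 z hz
    simp [hld z hz v]
    field_simp
    ring)
  rcases V.eq_empty_or_nonempty with rfl | ⟨z₀, hz₀⟩
  · exact ⟨0, contDiffOn_empty, by simp⟩
  have hc0 : c ≠ 0 := by
    rw [← hc z₀ hz₀]; exact mul_ne_zero (Complex.exp_ne_zero _) (hW0 _ hz₀)
  refine ⟨fun z => l z + Complex.log c, hl.add contDiffOn_const, fun z hz => ?_⟩
  rw [Complex.exp_add, Complex.exp_log hc0, ← hc z hz, ← mul_assoc, ← Complex.exp_add]
  simp

end Primitives

/-! ### Localization and the inverse function theorem -/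

section InverseFunction

/-- A smooth function agrees near a point with a globally smooth function of compact support. -/
theorem exists_contDiff_hasCompactSupport_eventuallyEq {E : Type*} [NormedAddCommGroup E]
    [NormedSpace ℝ E] [FiniteDimensional ℝ E] {h : E → ℝ} {Ω : Set E} (hΩ : IsOpen Ω) {x₀ : E}
    (hx₀ : x₀ ∈ Ω) (hh : ContDiffOn ℝ ∞ h Ω) :
    ∃ g : E → ℝ, ContDiff ℝ ∞ g ∧ HasCompactSupport g ∧ g =ᶠ[𝓝 x₀] h := by
  obtain ⟨ε, hε, hεΩ⟩ := Metric.nhds_basis_closedBall.mem_iff.1 (hΩ.mem_nhds hx₀)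
  let χ : ContDiffBump x₀ := ⟨ε / 2, ε, by positivity, by linarith⟩
  have hχ : tsupport χ ⊆ Ω := χ.tsupport_eq.trans_subset hεΩ
  refine ⟨fun x => χ x * h x, ?_, χ.hasCompactSupport.mul_right, ?_⟩
  · rw [contDiff_iff_contDiffAt]
    intro x
    by_cases hx : x ∈ tsupport χ
    · exact χ.contDiff.contDiffAt.mul (hh.contDiffAt (hΩ.mem_nhds (hχ hx)))
    · refine (contDiffAt_const (c := (0 : ℝ))).congr_of_eventuallyEq ?_
      filter_upwards [(isClosed_tsupport χ).isOpen_compl.mem_nhds hx] with y hy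
      simp [image_eq_zero_of_notMem_tsupport hy]
  · filter_upwards [χ.eventuallyEq_one] with x hx
    simp [hx]

/-- The inverse function theorem between spaces of the same finite dimension. Invertibility of the
differential is assumed on all of `Ω`, which makes the inverse smooth on its whole domain. -/
theorem exists_openPartialHomeomorph_of_injective_fderiv {E E' : Type*} [NormedAddCommGroup E]
    [NormedSpace ℝ E] [NormedAddCommGroup E'] [NormedSpace ℝ E'] [FiniteDimensional ℝ E]
    [FiniteDimensional ℝ E'] (hdim : Module.finrank ℝ E = Module.finrank ℝ E')
    {f : E → E'} {Ω : Set E} (hΩ : IsOpen Ω) {x₀ : E} (hx₀ : x₀ ∈ Ω) (hf : ContDiffOn ℝ ∞ f Ω)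
    (hinj : ∀ x ∈ Ω, Function.Injective (fderiv ℝ f x)) :
    ∃ e : OpenPartialHomeomorph E E', x₀ ∈ e.source ∧ e.source ⊆ Ω ∧ (∀ x, e x = f x) ∧
      ContDiffOn ℝ ∞ e.symm e.target := by
  have : CompleteSpace E := FiniteDimensional.complete ℝ E
  have hA : ∀ x ∈ Ω, ∃ A : E ≃L[ℝ] E', HasFDerivAt f (A : E →L[ℝ] E') x := by
    intro x hx
    refine ⟨(LinearEquiv.ofInjectiveOfFinrankEq (fderiv ℝ f x : E →ₗ[ℝ] E') (hinj x hx)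
      hdim).toContinuousLinearEquiv, ?_⟩
    convert hf.hasFDerivAt hΩ hx using 1
    ext v
    simp [LinearEquiv.ofInjectiveOfFinrankEq]
  obtain ⟨A, hA₀⟩ := hA x₀ hx₀
  have hc := hf.contDiffAt (hΩ.mem_nhds hx₀)
  let e := (hc.toOpenPartialHomeomorph f hA₀ (by simp)).restrOpen Ω hΩ
  have he : ∀ x, e x = f x := fun x => by
    simp [e, ContDiffAt.toOpenPartialHomeomorph_coe]
  refine ⟨e, ⟨hc.mem_toOpenPartialHomeomorph_source hA₀ (by simp), hx₀⟩, fun x hx => hx.2, he, ?_⟩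
  intro y hy
  have hs := e.map_target hy
  obtain ⟨B, hB⟩ := hA (e.symm y) hs.2
  have hfe : (e : E → E') = f := funext he
  refine (e.contDiffAt_symm (f₀' := B) hy ?_ ?_).contDiffWithinAt
  · rw [hfe]; exact hB
  · rw [hfe]; exact hf.contDiffAt (hΩ.mem_nhds hs.2)

end InverseFunction

/-! ### Smooth flows and characteristic coordinates -/

section Flow

/-- The interval `(-1, 1)`, for the time and for the initial value of the flow. -/
abbrev unitIoo : Set ℝ := Ioo (-1) 1

variable {h : ℝ × ℝ → ℝ}

/-- The flow `Y (x, c)` of `y' = h (x, y)` with initial value `c` at time `0`, as a continuous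
function of both variables (Picard–Lindelöf). -/
theorem exists_continuousOn_flow (hh : ContDiff ℝ ∞ h) (hc : HasCompactSupport h) :
    ∃ Y : ℝ × ℝ → ℝ, ContinuousOn Y (unitIoo ×ˢ unitIoo) ∧ (∀ c ∈ unitIoo, Y (0, c) = c) ∧
      ∀ x ∈ unitIoo, ∀ c ∈ unitIoo, HasDerivAt (fun x => Y (x, c)) (h (x, Y (x, c))) x := by
  obtain ⟨C, hC⟩ := hc.exists_bound_of_continuous hh.continuous
  obtain ⟨K, hK⟩ := ContDiff.lipschitzWith_of_hasCompactSupport hc hh (by simp)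
  have hC0 : 0 ≤ C := (norm_nonneg _).trans (hC 0)
  let C' : NNReal := ⟨C, hC0⟩
  have hpl : IsPicardLindelof (fun x y => h (x, y)) (tmin := -1) (tmax := 1)
      ⟨0, by norm_num⟩ 0 (C' + 1) 1 C' K := by
    refine ⟨fun t _ => ?_, fun x _ => ?_, fun t _ x _ => hC _, ?_⟩
    · exact LipschitzOnWith.of_dist_le_mul fun x _ y _ => by
        simpa [Prod.dist_eq] using hK.dist_le_mul (t, x) (t, y)
    · exact (hh.continuous.comp (by fun_prop)).continuousOn
    · simp
  obtain ⟨α, hα, hαc⟩ := hpl.exists_forall_mem_closedBall_eq_hasDerivWithinAt_continuousOn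
  have hball : ∀ c ∈ unitIoo, c ∈ Metric.closedBall (0 : ℝ) (1 : NNReal) := by
    intro c hc
    rw [Real.closedBall_eq_Icc]
    simpa using And.intro hc.1.le hc.2.le
  refine ⟨fun z => α (z.2, z.1), ?_, fun c hc => (hα c (hball c hc)).1, fun x hx c hc => ?_⟩
  · exact hαc.comp (by fun_prop) fun z hz => ⟨hball _ hz.2, Ioo_subset_Icc_self hz.1⟩
  · exact ((hα c (hball c hc)).2 x (Ioo_subset_Icc_self hx)).hasDerivAt (Icc_mem_nhds hx.1 hx.2)

/-- `∫₀ˣ ∂_y h (x', Y (x', c)) dx'` at `z = (x, c)`, the logarithm of `∂_c Y`; the integral is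
rescaled to `[0, 1]`. -/
noncomputable def flowLogDeriv (h Y : ℝ × ℝ → ℝ) (z : ℝ × ℝ) : ℝ :=
  ∫ θ in (0 : ℝ)..1, z.1 * fderiv ℝ h (θ * z.1, Y (θ * z.1, z.2)) (0, 1)

theorem mul_mem_unitIoo {θ x : ℝ} (hθ : θ ∈ Icc (0 : ℝ) 1) (hx : x ∈ unitIoo) :
    θ * x ∈ unitIoo := by
  constructor <;> nlinarith [hθ.1, hθ.2, hx.1, hx.2]

theorem contDiffOn_flowLogDeriv {Y : ℝ × ℝ → ℝ} {n : ℕ∞} (hh : ContDiff ℝ ∞ h)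
    (hY : ContDiffOn ℝ n Y (unitIoo ×ˢ unitIoo)) :
    ContDiffOn ℝ n (flowLogDeriv h Y) (unitIoo ×ˢ unitIoo) := by
  let m : (ℝ × ℝ) × ℝ → ℝ × ℝ := fun y => (y.2 * y.1.1, y.1.2)
  have hm : ContDiff ℝ n m := by fun_prop
  have hU : IsOpen (m ⁻¹' (unitIoo ×ˢ unitIoo)) :=
    (isOpen_Ioo.prod isOpen_Ioo).preimage hm.continuous
  have hYm : ContDiffOn ℝ n (fun y => Y (m y)) (m ⁻¹' (unitIoo ×ˢ unitIoo)) :=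
    hY.comp hm.contDiffOn fun _ h => h
  have hhy : ContDiff ℝ n (fun w => fderiv ℝ h w (0, 1)) :=
    ((contDiff_infty_iff_fderiv.1 hh).2.clm_apply contDiff_const).of_le
      (WithTop.coe_le_coe.2 le_top)
  refine contDiffOn_intervalIntegral (n := n) (V := unitIoo ×ˢ unitIoo)
    (g := fun y => y.1.1 * fderiv ℝ h (y.2 * y.1.1, Y (m y)) (0, 1)) hU ?_ ?_
  · rintro z hz θ hθ
    exact ⟨mul_mem_unitIoo hθ hz.1, hz.2⟩
  · exact ContDiffOn.mul (by fun_prop) (hhy.comp_contDiffOn (ContDiffOn.prodMk (by fun_prop) hYm))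

/-- The derivative of the flow in the initial value. The difference of two solutions satisfies a
linear equation, so that `Y (x, c') - Y (x, c) = (c' - c) * exp (J (x, c'))` holds exactly, with `J`
the time integral of the mean of `∂_y h` between the two solutions; `J` is continuous. -/
theorem hasDerivAt_flow_initial {Y : ℝ × ℝ → ℝ} (hh : ContDiff ℝ ∞ h)
    (hY : ContinuousOn Y (unitIoo ×ˢ unitIoo)) (hY0 : ∀ c ∈ unitIoo, Y (0, c) = c)
    (hYx : ∀ x ∈ unitIoo, ∀ c ∈ unitIoo, HasDerivAt (fun x => Y (x, c)) (h (x, Y (x, c))) x)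
    {x c : ℝ} (hx : x ∈ unitIoo) (hc : c ∈ unitIoo) :
    HasDerivAt (fun c => Y (x, c)) (Real.exp (flowLogDeriv h Y (x, c))) c := by
  -- The mean of `∂_y h` over the segment between the two solutions.
  let k : ℝ × ℝ → ℝ := fun w => ∫ θ in (0 : ℝ)..1,
    fderiv ℝ h (w.1, Y (w.1, c) + θ * (Y w - Y (w.1, c))) (0, 1)
  have hhy : ContDiff ℝ ∞ (fun w => fderiv ℝ h w (0, 1)) :=
    (contDiff_infty_iff_fderiv.1 hh).2.clm_apply contDiff_const
  have hhyc := hhy.continuous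
  have hW : IsOpen (unitIoo ×ˢ unitIoo) := isOpen_Ioo.prod isOpen_Ioo
  have hYc : ContinuousOn (fun w : ℝ × ℝ => Y (w.1, c)) (unitIoo ×ˢ unitIoo) :=
    hY.comp (by fun_prop) fun w hw => ⟨hw.1, hc⟩
  have hk : ContinuousOn k (unitIoo ×ˢ unitIoo) := by
    rw [← contDiffOn_zero (𝕜 := ℝ)]
    refine contDiffOn_intervalIntegral (n := 0)
      (g := fun y => fderiv ℝ h (y.1.1, Y (y.1.1, c) + y.2 * (Y y.1 - Y (y.1.1, c))) (0, 1))
      (hW.prod isOpen_univ) (fun z hz _ _ => ⟨hz, mem_univ _⟩) ?_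
    rw [WithTop.coe_zero, contDiffOn_zero]
    have h1 : ContinuousOn (fun y : (ℝ × ℝ) × ℝ => Y y.1) ((unitIoo ×ˢ unitIoo) ×ˢ univ) :=
      hY.comp (by fun_prop) fun w hw => hw.1
    have h2 : ContinuousOn (fun y : (ℝ × ℝ) × ℝ => Y (y.1.1, c)) ((unitIoo ×ˢ unitIoo) ×ˢ univ) :=
      hY.comp (f := fun y : (ℝ × ℝ) × ℝ => (y.1.1, c)) (by fun_prop) fun w hw => ⟨hw.1.1, hc⟩
    exact hhyc.comp_continuousOn (ContinuousOn.prodMk (by fun_prop)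
      (h2.add (ContinuousOn.mul (by fun_prop) (h1.sub h2))))
  have hkeq : ∀ w, h (w.1, Y w) - h (w.1, Y (w.1, c)) = (Y w - Y (w.1, c)) * k w := by
    intro w
    have hd : ∀ θ ∈ uIcc (0 : ℝ) 1, HasDerivAt
        (fun θ => h (w.1, Y (w.1, c) + θ * (Y w - Y (w.1, c))))
        ((Y w - Y (w.1, c)) * fderiv ℝ h (w.1, Y (w.1, c) + θ * (Y w - Y (w.1, c))) (0, 1)) θ := by
      intro θ _
      have h1 : HasDerivAt (fun θ : ℝ => (w.1, Y (w.1, c) + θ * (Y w - Y (w.1, c))))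
          (0, Y w - Y (w.1, c)) θ := by
        have := ((hasDerivAt_id θ).mul_const (Y w - Y (w.1, c))).const_add (Y (w.1, c))
        simpa using (hasDerivAt_const θ w.1).prodMk this
      have := ((hh.differentiable (by simp)) _).hasFDerivAt.comp_hasDerivAt θ h1
      have e : ((0 : ℝ), Y w - Y (w.1, c)) = (Y w - Y (w.1, c)) • ((0 : ℝ), (1 : ℝ)) := by simp
      rw [e, map_smul, smul_eq_mul] at this
      exact this
    have := intervalIntegral.integral_eq_sub_of_hasDerivAt hd
      (Continuous.intervalIntegrable (by fun_prop) _ _)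
    rw [intervalIntegral.integral_const_mul] at this
    simpa using this.symm
  let J : ℝ × ℝ → ℝ := fun w => ∫ θ in (0 : ℝ)..1, w.1 * k (θ * w.1, w.2)
  have hJ : ContinuousOn J (unitIoo ×ˢ unitIoo) := by
    rw [← contDiffOn_zero (𝕜 := ℝ)]
    let m : (ℝ × ℝ) × ℝ → ℝ × ℝ := fun y => (y.2 * y.1.1, y.1.2)
    have hm : Continuous m := by fun_prop
    refine contDiffOn_intervalIntegral (n := 0)
      (g := fun y => y.1.1 * k (m y))
      (hW.preimage hm) (fun z hz θ hθ => ⟨mul_mem_unitIoo hθ hz.1, hz.2⟩) ?_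
    rw [WithTop.coe_zero, contDiffOn_zero]
    exact ContinuousOn.mul (by fun_prop) (hk.comp hm.continuousOn fun _ h => h)
  have hJeq : ∀ w : ℝ × ℝ, J w = ∫ r in (0 : ℝ)..w.1, k (r, w.2) := by
    intro w
    have := intervalIntegral.smul_integral_comp_mul_add (a := 0) (b := 1)
      (fun r => k (r, w.2)) w.1 0
    simp only [mul_zero, add_zero, mul_one, smul_eq_mul, ← intervalIntegral.integral_const_mul]
      at this
    rw [← this]
    simp only [J, mul_comm w.1]
  have hJd : ∀ r ∈ unitIoo, ∀ c' ∈ unitIoo, HasDerivAt (fun r => J (r, c')) (k (r, c')) r := by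
    intro r hr c' hc'
    have h1 : ContinuousOn (fun r => k (r, c')) unitIoo :=
      hk.comp (by fun_prop) fun r hr => ⟨hr, hc'⟩
    have h2 : uIcc 0 r ⊆ unitIoo := ordConnected_Ioo.uIcc_subset (by norm_num) hr
    simp only [hJeq]
    exact intervalIntegral.integral_hasDerivAt_right (h1.mono h2).intervalIntegrable
      (h1.stronglyMeasurableAtFilter isOpen_Ioo r hr) (h1.continuousAt (isOpen_Ioo.mem_nhds hr))
  have hdiff : ∀ c' ∈ unitIoo, Y (x, c') - Y (x, c) = (c' - c) * Real.exp (J (x, c')) := by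
    intro c' hc'
    have hd : ∀ r ∈ unitIoo, HasDerivAt
        (fun r => (Y (r, c') - Y (r, c)) * Real.exp (-J (r, c'))) 0 r := by
      intro r hr
      have := ((hYx r hr c' hc').sub (hYx r hr c hc)).fun_mul (hJd r hr c' hc').fun_neg.exp
      refine this.congr_deriv ?_
      have e := hkeq (r, c')
      simp only at e
      simp only [Pi.sub_apply]
      rw [e]
      ring
    have := isOpen_Ioo.is_const_of_deriv_eq_zero isPreconnected_Ioo
      (fun r hr => (hd r hr).differentiableAt.differentiableWithinAt)
      (fun r hr => (hd r hr).deriv) hx (show (0 : ℝ) ∈ unitIoo by norm_num)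
    have hJ0 : J (0, c') = 0 := by simp [J]
    simp only [hY0 c' hc', hY0 c hc, hJ0, neg_zero, Real.exp_zero, mul_one] at this
    rw [← this, mul_assoc, ← Real.exp_add]
    simp
  have hJc : J (x, c) = flowLogDeriv h Y (x, c) := by
    simp [J, k, flowLogDeriv]
  rw [← hJc, hasDerivAt_iff_tendsto_slope]
  have hlim : Tendsto (fun c' => Real.exp (J (x, c'))) (𝓝[≠] c) (𝓝 (Real.exp (J (x, c)))) := by
    have h1 : ContinuousAt J (x, c) := hJ.continuousAt (hW.mem_nhds ⟨hx, hc⟩)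
    have h2 : ContinuousAt (fun c' => J (x, c')) c :=
      ContinuousAt.comp (f := fun c' => (x, c')) h1 (by fun_prop)
    exact (Real.continuous_exp.continuousAt.comp h2).tendsto.mono_left nhdsWithin_le_nhds
  refine hlim.congr' ?_
  filter_upwards [nhdsWithin_le_nhds (isOpen_Ioo.mem_nhds hc), self_mem_nhdsWithin] with c' hc' hne
  have hne' : c' - c ≠ 0 := sub_ne_zero.2 hne
  rw [slope_def_field, hdiff c' hc']
  field_simp

/-- The flow is smooth: its partial derivatives are `h (x, Y)` and `exp (flowLogDeriv h Y)`, and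
both are as often differentiable as `Y`. -/
theorem exists_smooth_flow (hh : ContDiff ℝ ∞ h) (hc : HasCompactSupport h) :
    ∃ Y : ℝ × ℝ → ℝ, ContDiffOn ℝ ∞ Y (unitIoo ×ˢ unitIoo) ∧ (∀ c ∈ unitIoo, Y (0, c) = c) ∧
      ∀ z ∈ unitIoo ×ˢ unitIoo,
        fderiv ℝ Y z (1, 0) = h (z.1, Y z) ∧ 0 < fderiv ℝ Y z (0, 1) := by
  obtain ⟨Y, hY, hY0, hYx⟩ := exists_continuousOn_flow hh hc
  have hW : IsOpen (unitIoo ×ˢ unitIoo) := isOpen_Ioo.prod isOpen_Ioo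
  have hfd : ∀ z ∈ unitIoo ×ˢ unitIoo, HasFDerivAt Y
      ((ContinuousLinearMap.toSpanSingleton ℝ (h (z.1, Y z))).coprod
        (ContinuousLinearMap.toSpanSingleton ℝ (Real.exp (flowLogDeriv h Y z)))) z := by
    intro z hz
    have hcY : ContinuousAt Y z := hY.continuousAt (hW.mem_nhds hz)
    have hcL : ContinuousAt (flowLogDeriv h Y) z :=
      ((contDiffOn_flowLogDeriv (n := 0) hh (contDiffOn_zero.2 hY)).continuousOn).continuousAt
        (hW.mem_nhds hz)
    have := (hasStrictFDerivAt_uncurry_coprod (u := z) (f := fun a b => Y (a, b))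
      (f₁ := fun a b => ContinuousLinearMap.toSpanSingleton ℝ (h (a, Y (a, b))))
      (f₂ := fun a b => ContinuousLinearMap.toSpanSingleton ℝ (Real.exp (flowLogDeriv h Y (a, b))))
      (by filter_upwards [hW.mem_nhds hz] with v hv
          exact (hYx v.1 hv.1 v.2 hv.2).hasFDerivAt)
      (by filter_upwards [hW.mem_nhds hz] with v hv
          exact (hasDerivAt_flow_initial hh hY hY0 hYx hv.1 hv.2).hasFDerivAt)
      (by
        have : ContinuousAt (fun w : ℝ × ℝ => h (w.1, Y w)) z :=
          hh.continuous.continuousAt.comp (continuousAt_fst.prodMk hcY)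
        exact
          (ContinuousLinearMap.toSpanSingletonCLE (𝕜 := ℝ) (E := ℝ)).continuous.continuousAt.comp
            this)
      (by
        exact
          (ContinuousLinearMap.toSpanSingletonCLE (𝕜 := ℝ) (E := ℝ)).continuous.continuousAt.comp
            (Real.continuous_exp.continuousAt.comp hcL))).hasFDerivAt
    exact this
  have hn : ∀ n : ℕ, ContDiffOn ℝ n Y (unitIoo ×ˢ unitIoo) := by
    intro n
    induction n with
    | zero => exact contDiffOn_zero.2 hY
    | succ n ih =>
      rw [Nat.cast_succ, contDiffOn_succ_iff_fderiv_of_isOpen hW]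
      refine ⟨fun z hz => (hfd z hz).differentiableAt.differentiableWithinAt, by simp, ?_⟩
      have h1 : ContDiffOn ℝ n (fun z => h (z.1, Y z)) (unitIoo ×ˢ unitIoo) :=
        (hh.of_le (mod_cast le_top)).comp_contDiffOn (contDiffOn_fst.prodMk ih)
      have h2 : ContDiffOn ℝ n (fun z => Real.exp (flowLogDeriv h Y z)) (unitIoo ×ˢ unitIoo) :=
        (contDiffOn_flowLogDeriv (n := n) hh ih).exp
      have h3 : ContDiffOn ℝ n (fun z =>
          h (z.1, Y z) • ContinuousLinearMap.fst ℝ ℝ ℝ +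
          Real.exp (flowLogDeriv h Y z) • ContinuousLinearMap.snd ℝ ℝ ℝ) (unitIoo ×ˢ unitIoo) :=
        (h1.smul contDiffOn_const).add (h2.smul contDiffOn_const)
      refine h3.congr fun z hz => ?_
      rw [(hfd z hz).fderiv]
      ext <;> simp
  refine ⟨Y, contDiffOn_infty.2 hn, hY0, fun z hz => ?_⟩
  rw [(hfd z hz).fderiv]
  constructor
  · simp
  · simpa using Real.exp_pos _

end Flow

/-- Characteristic coordinates: near a point, `∂₁ t + h ∂₂ t = 0` has a smooth solution with
`∂₂ t > 0`, the initial value `c` of the integral curve of `y' = h (x, y)` through a point. -/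
theorem exists_characteristic_coordinate {h : ℝ × ℝ → ℝ} {Ω : Set (ℝ × ℝ)} (hΩ : IsOpen Ω)
    (h0 : (0 : ℝ × ℝ) ∈ Ω) (hh : ContDiffOn ℝ ∞ h Ω) :
    ∃ (U : Set (ℝ × ℝ)) (t : ℝ × ℝ → ℝ), IsOpen U ∧ 0 ∈ U ∧ ContDiffOn ℝ ∞ t U ∧
      ∀ z ∈ U, fderiv ℝ t z (1, h z) = 0 ∧ 0 < fderiv ℝ t z (0, 1) := by
  obtain ⟨g, hg, hgc, hgh⟩ := exists_contDiff_hasCompactSupport_eventuallyEq hΩ h0 hh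
  obtain ⟨Y, hY, hY0, hYd⟩ := exists_smooth_flow hg hgc
  have hW : IsOpen (unitIoo ×ˢ unitIoo) := isOpen_Ioo.prod isOpen_Ioo
  let Ψ : ℝ × ℝ → ℝ × ℝ := fun z => (z.1, Y z)
  have hΨ : ContDiffOn ℝ ∞ Ψ (unitIoo ×ˢ unitIoo) := contDiffOn_fst.prodMk hY
  have hΨd : ∀ z ∈ unitIoo ×ˢ unitIoo, ∀ v, fderiv ℝ Ψ z v = (v.1, fderiv ℝ Y z v) := by
    intro z hz v
    have : HasFDerivAt Ψ ((ContinuousLinearMap.fst ℝ ℝ ℝ).prod (fderiv ℝ Y z)) z :=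
      hasFDerivAt_fst.prodMk (hY.hasFDerivAt hW hz)
    rw [this.fderiv]; rfl
  have h00 : (0 : ℝ × ℝ) ∈ unitIoo ×ˢ unitIoo := by constructor <;> simp
  obtain ⟨e, he0, heW, heΨ, hes⟩ := exists_openPartialHomeomorph_of_injective_fderiv rfl hW h00 hΨ
    (fun z hz => by
      rw [injective_iff_map_eq_zero]
      intro v hv
      rw [hΨd z hz] at hv
      have h1 : v.1 = 0 := congrArg Prod.fst hv
      have h2 : fderiv ℝ Y z v = 0 := congrArg Prod.snd hv
      have e : v = v.2 • ((0 : ℝ), (1 : ℝ)) := by ext <;> simp [h1]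
      rw [e, map_smul, smul_eq_mul] at h2
      have h3 := (mul_eq_zero.1 h2).resolve_right (hYd z hz).2.ne'
      ext <;> simp [h1, h3])
  have h0t : (0 : ℝ × ℝ) ∈ e.target := by
    have := e.map_source he0
    rw [heΨ] at this
    have e0 : Ψ 0 = 0 := by
      have : Y 0 = 0 := hY0 0 (by norm_num)
      ext <;> simp [Ψ, this]
    rwa [e0] at this
  obtain ⟨O, hO, hOo, hO0⟩ := eventually_nhds_iff.1 hgh
  have ht : ContDiffOn ℝ ∞ (fun z => (e.symm z).2) e.target := contDiff_snd.comp_contDiffOn hes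
  refine ⟨e.target ∩ O, fun z => (e.symm z).2, e.open_target.inter hOo, ⟨h0t, hO0⟩,
    ht.mono inter_subset_left, ?_⟩
  rintro z ⟨hz, hzO⟩
  have hw := e.map_target hz
  have hwW := heW hw
  have hΨw : Ψ (e.symm z) = z := by rw [← heΨ, e.right_inv hz]
  have hcomp : HasFDerivAt (fun w => (e.symm (Ψ w)).2)
      ((fderiv ℝ (fun z => (e.symm z).2) z).comp (fderiv ℝ Ψ (e.symm z))) (e.symm z) := by
    refine HasFDerivAt.comp (g := fun z => (e.symm z).2) (e.symm z) ?_ (hΨ.hasFDerivAt hW hwW)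
    rw [hΨw]
    exact ht.hasFDerivAt e.open_target hz
  have hcomp' : HasFDerivAt (fun w => (e.symm (Ψ w)).2) (ContinuousLinearMap.snd ℝ ℝ ℝ)
      (e.symm z) := by
    refine hasFDerivAt_snd.congr_of_eventuallyEq ?_
    filter_upwards [e.open_source.mem_nhds hw] with w hw
    rw [← heΨ, e.left_inv hw]
  have hv : ∀ v : ℝ × ℝ,
      fderiv ℝ (fun z => (e.symm z).2) z (v.1, fderiv ℝ Y (e.symm z) v) = v.2 := by
    intro v
    rw [← hΨd _ hwW]
    exact DFunLike.congr_fun (hcomp.unique hcomp') v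
  obtain ⟨hY1, hY2⟩ := hYd _ hwW
  constructor
  · have := hv (1, 0)
    rw [hY1] at this
    rw [← hO z hzO]
    convert this using 3
    exact congrArg g hΨw.symm
  · have := hv (0, 1)
    have e1 : ((0 : ℝ), fderiv ℝ Y (e.symm z) (0, 1)) =
      fderiv ℝ Y (e.symm z) (0, 1) • ((0 : ℝ), (1 : ℝ)) := by simp
    simp only at this
    rw [e1, map_smul, smul_eq_mul] at this
    by_contra hneg
    have := mul_nonpos_of_nonneg_of_nonpos hY2.le (not_lt.1 hneg)
    linarith

/-! ### Line integrals along piecewise smooth paths -/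

section CurveIntegral

open LorentzNumber

variable {G : Type*} [NormedAddCommGroup G] [NormedSpace ℝ G] [CompleteSpace G]

/-- The fundamental theorem of calculus for piecewise `C¹` paths. -/
theorem curveIntegral_eq_sub_of_piecewiseC1 {V : Set LorentzNumber} {f : LorentzNumber → G}
    {w : LorentzNumber → LorentzNumber →L[ℝ] G} (hf : ∀ z ∈ V, HasFDerivAt f (w z) z)
    (hw : ContinuousOn w V) {x y : LorentzNumber} {γ : Path x y} (hγ : PiecewiseC1 γ)
    (hγV : ∀ t, γ t ∈ V) : curveIntegral w γ = f y - f x := by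
  obtain ⟨n, t, ht, ht0, ht1, hC1⟩ := hγ
  have hmem : ∀ r, γ.extend r ∈ V := fun r => by
    exact hγV (projIcc 0 1 zero_le_one r)
  let a : ℕ → ℝ := fun k => if h : k < n + 1 then t ⟨k, h⟩ else 1
  have ha : ∀ k (h : k < n + 1), a k = t ⟨k, h⟩ := fun k h => dif_pos h
  have ha0 : a 0 = 0 := by rw [ha 0 (by omega)]; exact ht0
  have han : a n = 1 := by rw [ha n (by omega)]; exact ht1
  have hlt : ∀ k < n, a k < a (k + 1) := by
    intro k hk
    rw [ha k (by omega), ha (k + 1) (by omega)]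
    exact ht (by simp [Fin.lt_def])
  have hC : ∀ k < n, ContDiffOn ℝ 1 γ.extend (Icc (a k) (a (k + 1))) := by
    intro k hk
    rw [ha k (by omega), ha (k + 1) (by omega)]
    exact hC1 ⟨k, hk⟩
  -- On each closed piece the integrand agrees, off the endpoints, with a continuous function.
  have hint : ∀ k < n, IntervalIntegrable (fun r => w (γ.extend r) (deriv γ.extend r))
      MeasureTheory.volume (a k) (a (k + 1)) := by
    intro k hk
    have h1 : ContinuousOn
        (fun r => w (γ.extend r) (derivWithin γ.extend (Icc (a k) (a (k + 1))) r))
        (Icc (a k) (a (k + 1))) :=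
      (hw.comp γ.continuous_extend.continuousOn fun r _ => hmem r).clm_apply
        ((hC k hk).continuousOn_derivWithin (uniqueDiffOn_Icc (hlt k hk)) le_rfl)
    refine (h1.intervalIntegrable_of_Icc (hlt k hk).le).congr_ae ?_
    rw [uIoc_of_le (hlt k hk).le, ← MeasureTheory.restrict_Ioo_eq_restrict_Ioc]
    filter_upwards [MeasureTheory.ae_restrict_mem measurableSet_Ioo] with r hr
    rw [derivWithin_of_mem_nhds (Icc_mem_nhds hr.1 hr.2)]
  have hpiece : ∀ k < n, ∫ r in a k..a (k + 1), w (γ.extend r) (deriv γ.extend r) =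
      f (γ.extend (a (k + 1))) - f (γ.extend (a k)) := by
    intro k hk
    refine intervalIntegral.integral_eq_sub_of_hasDerivAt_of_le
      (f := fun r => f (γ.extend r)) (hlt k hk).le ?_ ?_ (hint k hk)
    · intro r _
      exact ((hf _ (hmem r)).continuousAt.comp γ.continuous_extend.continuousAt).continuousWithinAt
    · intro r hr
      have hd : DifferentiableAt ℝ γ.extend r :=
        (((hC k hk).differentiableOn (by simp)) r (Ioo_subset_Icc_self hr)).differentiableAt
          (Icc_mem_nhds hr.1 hr.2)
      exact (hf _ (hmem r)).comp_hasDerivAt r hd.hasDerivAt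
  rw [curveIntegral_eq_intervalIntegral_deriv, ← ha0, ← han,
    ← intervalIntegral.sum_integral_adjacent_intervals hint,
    Finset.sum_congr rfl fun k hk => hpiece k (Finset.mem_range.1 hk),
    Finset.sum_range_sub (fun k => f (γ.extend (a k))), ha0, han, γ.extend_zero, γ.extend_one]

theorem piecewiseC1_segment (x y : LorentzNumber) : PiecewiseC1 (Path.segment x y) := by
  refine ⟨1, ![0, 1], ?_, rfl, rfl, fun i => ?_⟩
  · rw [Fin.strictMono_iff_lt_succ]
    intro i; fin_cases i; simp
  · fin_cases i
    have h := Path.eqOn_extend_segment x y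
    refine ContDiffOn.congr (f := AffineMap.lineMap x y) ?_ (fun r hr => h hr)
    have : ContDiff ℝ 1 (fun r : ℝ => r • (y - x) + x) := by fun_prop
    refine this.contDiffOn.congr fun r _ => ?_
    simp [AffineMap.lineMap_apply]

end CurveIntegral

/-! ### Null components of Lorentz numbers -/

namespace LorentzNumber

noncomputable section

/-- The value of a Lorentz number at `σ = 1`, its first null component. -/
def nullFst : LorentzNumber →L[ℝ] ℝ :=
  LinearMap.toContinuousLinearMap
    (QuadraticAlgebra.reₗ (1 : ℝ) 0 + QuadraticAlgebra.imₗ (1 : ℝ) 0 : LorentzNumber →ₗ[ℝ] ℝ)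

/-- The value of a Lorentz number at `σ = -1`, its second null component. -/
def nullSnd : LorentzNumber →L[ℝ] ℝ :=
  LinearMap.toContinuousLinearMap
    (QuadraticAlgebra.reₗ (1 : ℝ) 0 - QuadraticAlgebra.imₗ (1 : ℝ) 0 : LorentzNumber →ₗ[ℝ] ℝ)

theorem nullFst_apply (z : LorentzNumber) : nullFst z = z.re + z.im := rfl
theorem nullSnd_apply (z : LorentzNumber) : nullSnd z = z.re - z.im := rfl

theorem ext_null {z w : LorentzNumber} (h₁ : nullFst z = nullFst w) (h₂ : nullSnd z = nullSnd w) :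
    z = w := by
  rw [nullFst_apply, nullFst_apply] at h₁
  rw [nullSnd_apply, nullSnd_apply] at h₂
  exact QuadraticAlgebra.ext (by linarith) (by linarith)

/-- The Lorentz number with null components `x` and `y`. -/
def ofNull (x : ℝ × ℝ) : LorentzNumber := ⟨(x.1 + x.2) / 2, (x.1 - x.2) / 2⟩

@[simp] theorem nullFst_ofNull (x : ℝ × ℝ) : nullFst (ofNull x) = x.1 := by
  simp only [nullFst_apply, ofNull]; ring

@[simp] theorem nullSnd_ofNull (x : ℝ × ℝ) : nullSnd (ofNull x) = x.2 := by
  simp only [nullSnd_apply, ofNull]; ring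

@[simp] theorem nullFst_mul (z w : LorentzNumber) : nullFst (z * w) = nullFst z * nullFst w := by
  simp [nullFst_apply]; ring

@[simp] theorem nullSnd_mul (z w : LorentzNumber) : nullSnd (z * w) = nullSnd z * nullSnd w := by
  simp [nullSnd_apply]; ring

@[simp] theorem nullFst_star (z : LorentzNumber) : nullFst (star z) = nullSnd z := by
  simp [nullFst_apply, nullSnd_apply]; ring

@[simp] theorem nullSnd_star (z : LorentzNumber) : nullSnd (star z) = nullFst z := by
  simp [nullFst_apply, nullSnd_apply]

@[simp] theorem nullFst_one : nullFst 1 = 1 := by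
  simp [nullFst_apply, QuadraticAlgebra.re_one, QuadraticAlgebra.im_one]
@[simp] theorem nullSnd_one : nullSnd 1 = 1 := by
  simp [nullSnd_apply, QuadraticAlgebra.re_one, QuadraticAlgebra.im_one]
@[simp] theorem nullFst_sigma : nullFst sigma = 1 := by simp [nullFst_apply, sigma]
@[simp] theorem nullSnd_sigma : nullSnd sigma = -1 := by simp [nullSnd_apply, sigma]
@[simp] theorem nullFst_algebraMap (c : ℝ) : nullFst (algebraMap ℝ LorentzNumber c) = c := by
  simp [nullFst_apply]
@[simp] theorem nullSnd_algebraMap (c : ℝ) : nullSnd (algebraMap ℝ LorentzNumber c) = c := by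
  simp [nullSnd_apply]

theorem norm_eq (z : LorentzNumber) : QuadraticAlgebra.norm z = nullFst z * nullSnd z := by
  simp [QuadraticAlgebra.norm_def, nullFst_apply, nullSnd_apply]; ring

theorem daDaHat_eq (X Y : LorentzNumber) :
    daDaHat X Y = (nullFst X * nullSnd Y + nullSnd X * nullFst Y) / 2 := by
  simp [daDaHat, nullFst_apply, nullSnd_apply]; ring

/-- The null coordinates `(u + v, u - v)`. -/
def nullEquiv : LorentzNumber ≃L[ℝ] ℝ × ℝ :=
  LinearEquiv.toContinuousLinearEquiv
    { toFun := fun z => (nullFst z, nullSnd z)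
      map_add' := fun z w => by simp
      map_smul' := fun c z => by simp
      invFun := ofNull
      left_inv := fun z => ext_null (by simp) (by simp)
      right_inv := fun x => by simp }

@[simp] theorem nullEquiv_apply (z : LorentzNumber) : nullEquiv z = (nullFst z, nullSnd z) := rfl
@[simp] theorem nullEquiv_symm_apply (x : ℝ × ℝ) : nullEquiv.symm x = ofNull x := rfl

/-- The null coordinates `(u - v, u + v)`. -/
def nullEquiv' : LorentzNumber ≃L[ℝ] ℝ × ℝ :=
  nullEquiv.trans (ContinuousLinearEquiv.prodComm ℝ ℝ ℝ)

@[simp] theorem nullEquiv'_apply (z : LorentzNumber) : nullEquiv' z = (nullSnd z, nullFst z) := rfl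
@[simp] theorem nullEquiv'_symm_apply (x : ℝ × ℝ) : nullEquiv'.symm x = ofNull x.swap := rfl

/-- The null vector `∂/∂(u + v)`. -/
def vecFst : LorentzNumber := ofNull (1, 0)

/-- The null vector `∂/∂(u - v)`. -/
def vecSnd : LorentzNumber := ofNull (0, 1)

@[simp] theorem nullFst_vecFst : nullFst vecFst = 1 := by simp [vecFst]
@[simp] theorem nullSnd_vecFst : nullSnd vecFst = 0 := by simp [vecFst]
@[simp] theorem nullFst_vecSnd : nullFst vecSnd = 0 := by simp [vecSnd]
@[simp] theorem nullSnd_vecSnd : nullSnd vecSnd = 1 := by simp [vecSnd]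

theorem eq_smul_add_smul (X : LorentzNumber) : X = nullFst X • vecFst + nullSnd X • vecSnd :=
  ext_null (by simp) (by simp)

theorem map_eq_null {G : Type*} [NormedAddCommGroup G] [NormedSpace ℝ G]
    (L : LorentzNumber →L[ℝ] G) (X : LorentzNumber) :
    L X = nullFst X • L vecFst + nullSnd X • L vecSnd := by
  conv_lhs => rw [eq_smul_add_smul X]
  simp

/-- In null components, `∂_a` is `∂/∂(u + v)` on the first and `∂/∂(u - v)` on the second. -/
theorem partialA_eq_iff {f : LorentzNumber → LorentzNumber} {z w : LorentzNumber}
    (hf : DifferentiableAt ℝ f z) :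
    partialA f z = w ↔ fderiv ℝ (fun x => nullFst (f x)) z vecFst = nullFst w ∧
      fderiv ℝ (fun x => nullSnd (f x)) z vecSnd = nullSnd w := by
  have h1 : fderiv ℝ (fun x => nullFst (f x)) z = nullFst.comp (fderiv ℝ f z) :=
    (nullFst.hasFDerivAt.comp z hf.hasFDerivAt).fderiv
  have h2 : fderiv ℝ (fun x => nullSnd (f x)) z = nullSnd.comp (fderiv ℝ f z) :=
    (nullSnd.hasFDerivAt.comp z hf.hasFDerivAt).fderiv
  have e1 : nullFst (partialA f z) = nullFst (fderiv ℝ f z vecFst) := by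
    rw [partialA, map_eq_null (fderiv ℝ f z) 1, map_eq_null (fderiv ℝ f z) sigma]
    simp; ring
  have e2 : nullSnd (partialA f z) = nullSnd (fderiv ℝ f z vecSnd) := by
    rw [partialA, map_eq_null (fderiv ℝ f z) 1, map_eq_null (fderiv ℝ f z) sigma]
    simp; ring
  rw [h1, h2]
  simp only [ContinuousLinearMap.comp_apply]
  rw [← e1, ← e2]
  exact ⟨fun h => by simp [h], fun h => ext_null h.1 h.2⟩

/-- In null components, `∂_â` is `∂/∂(u - v)` on the first and `∂/∂(u + v)` on the second. -/
theorem partialAHat_eq_iff {f : LorentzNumber → LorentzNumber} {z w : LorentzNumber}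
    (hf : DifferentiableAt ℝ f z) :
    partialAHat f z = w ↔ fderiv ℝ (fun x => nullFst (f x)) z vecSnd = nullFst w ∧
      fderiv ℝ (fun x => nullSnd (f x)) z vecFst = nullSnd w := by
  have h1 : fderiv ℝ (fun x => nullFst (f x)) z = nullFst.comp (fderiv ℝ f z) :=
    (nullFst.hasFDerivAt.comp z hf.hasFDerivAt).fderiv
  have h2 : fderiv ℝ (fun x => nullSnd (f x)) z = nullSnd.comp (fderiv ℝ f z) :=
    (nullSnd.hasFDerivAt.comp z hf.hasFDerivAt).fderiv
  have e1 : nullFst (partialAHat f z) = nullFst (fderiv ℝ f z vecSnd) := by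
    rw [partialAHat, map_eq_null (fderiv ℝ f z) 1, map_eq_null (fderiv ℝ f z) sigma]
    simp; ring
  have e2 : nullSnd (partialAHat f z) = nullSnd (fderiv ℝ f z vecFst) := by
    rw [partialAHat, map_eq_null (fderiv ℝ f z) 1, map_eq_null (fderiv ℝ f z) sigma]
    simp; ring
  rw [h1, h2]
  simp only [ContinuousLinearMap.comp_apply]
  rw [← e1, ← e2]
  exact ⟨fun h => by simp [h], fun h => ext_null h.1 h.2⟩

end

end LorentzNumber

/-! ### Rank one tensors -/

namespace R22

noncomputable section

/-- The rank one tensor `x ⊗ y`, where `P` in `ℝ^{2,2}` stands for the `2 × 2` matrix with rows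
`(-(P₀ + P₁), P₂ + P₃)` and `(P₂ - P₃, P₀ - P₁)`. The quadratic form of `ℝ^{2,2}` is the
determinant of this matrix, so that the null vectors are exactly the rank one tensors. -/
def tmul : (ℝ × ℝ) →L[ℝ] (ℝ × ℝ) →L[ℝ] R22 :=
  LinearMap.toContinuousBilinearMap (LinearMap.mk₂ ℝ (fun x y =>
    (![(x.2 * y.2 - x.1 * y.1) / 2, (-(x.2 * y.2) - x.1 * y.1) / 2,
      (x.1 * y.2 + x.2 * y.1) / 2, (x.1 * y.2 - x.2 * y.1) / 2] : R22))
    (fun x x' y => by ext i; fin_cases i <;> simp <;> ring)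
    (fun c x y => by ext i; fin_cases i <;> simp <;> ring)
    (fun x y y' => by ext i; fin_cases i <;> simp <;> ring)
    (fun c x y => by ext i; fin_cases i <;> simp <;> ring))

@[simp] theorem tmul_zero_apply (x y : ℝ × ℝ) : tmul x y 0 = (x.2 * y.2 - x.1 * y.1) / 2 := rfl
@[simp] theorem tmul_one_apply (x y : ℝ × ℝ) : tmul x y 1 = (-(x.2 * y.2) - x.1 * y.1) / 2 := rfl
@[simp] theorem tmul_two_apply (x y : ℝ × ℝ) : tmul x y 2 = (x.1 * y.2 + x.2 * y.1) / 2 := rfl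
@[simp] theorem tmul_three_apply (x y : ℝ × ℝ) : tmul x y 3 = (x.1 * y.2 - x.2 * y.1) / 2 := rfl

/-- The area form of the plane. -/
def area (x y : ℝ × ℝ) : ℝ := x.1 * y.2 - x.2 * y.1

/-- The metric of `ℝ^{2,2}` is half the tensor product of two copies of the area form. -/
theorem ip_tmul (x y x' y' : ℝ × ℝ) :
    ip (tmul x y) (tmul x' y') = area x x' * area y y' / 2 := by
  simp [ip, area]; ring

theorem ip_comm (x y : R22) : ip x y = ip y x := by simp only [ip]; ring
theorem ip_add_left (x y z : R22) : ip (x + y) z = ip x z + ip y z := by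
  simp only [ip, Pi.add_apply]; ring
theorem ip_add_right (x y z : R22) : ip x (y + z) = ip x y + ip x z := by
  simp only [ip, Pi.add_apply]; ring
theorem ip_smul_left (c : ℝ) (x y : R22) : ip (c • x) y = c * ip x y := by
  simp only [ip, Pi.smul_apply, smul_eq_mul]; ring
theorem ip_smul_right (c : ℝ) (x y : R22) : ip x (c • y) = c * ip x y := by
  simp only [ip, Pi.smul_apply, smul_eq_mul]; ring

end

end R22

/-! ### From spinors to surfaces -/

namespace Weierstrass

noncomputable section

open LorentzNumber R22

variable {V : Set LorentzNumber} {φ₁ φ₂ ψ₁ ψ₂ : LorentzNumber → LorentzNumber}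
  {p q : LorentzNumber → ℝ} {F : LorentzNumber → R22} {z : LorentzNumber}

/-- The first null components of a pair of Lorentz valued functions, a spinor in the plane. -/
def plusSpinor (f g : LorentzNumber → LorentzNumber) (z : LorentzNumber) : ℝ × ℝ :=
  (nullFst (f z), nullFst (g z))

/-- The second null components of a pair of Lorentz valued functions, a spinor in the plane. -/
def minusSpinor (f g : LorentzNumber → LorentzNumber) (z : LorentzNumber) : ℝ × ℝ :=
  (nullSnd (f z), nullSnd (g z))

theorem density_eq (φ₁ φ₂ ψ₁ ψ₂ : LorentzNumber → LorentzNumber) (z : LorentzNumber) :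
    density φ₁ φ₂ ψ₁ ψ₂ z = -(area (plusSpinor ψ₁ ψ₂ z) (plusSpinor φ₁ φ₂ z) *
      area (minusSpinor φ₁ φ₂ z) (minusSpinor ψ₁ ψ₂ z)) := by
  rw [density, norm_eq]
  simp [area, plusSpinor, minusSpinor]
  ring

/-- The vector valued `1`-form integrated by the representation formula, split into its parts
along the two null directions. -/
def spinorForm (φ₁ φ₂ ψ₁ ψ₂ : LorentzNumber → LorentzNumber) (z : LorentzNumber) :
    LorentzNumber →L[ℝ] R22 :=
  nullFst.smulRight (tmul (plusSpinor ψ₁ ψ₂ z) (minusSpinor φ₁ φ₂ z)) +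
    nullSnd.smulRight (tmul (plusSpinor φ₁ φ₂ z) (minusSpinor ψ₁ ψ₂ z))

theorem spinorForm_apply (X : LorentzNumber) : spinorForm φ₁ φ₂ ψ₁ ψ₂ z X =
    nullFst X • tmul (plusSpinor ψ₁ ψ₂ z) (minusSpinor φ₁ φ₂ z) +
      nullSnd X • tmul (plusSpinor φ₁ φ₂ z) (minusSpinor ψ₁ ψ₂ z) := rfl

theorem contDiffOn_plusSpinor {f g : LorentzNumber → LorentzNumber} (hf : ContDiffOn ℝ ∞ f V)
    (hg : ContDiffOn ℝ ∞ g V) : ContDiffOn ℝ ∞ (plusSpinor f g) V :=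
  (nullFst.contDiff.comp_contDiffOn hf).prodMk (nullFst.contDiff.comp_contDiffOn hg)

theorem contDiffOn_minusSpinor {f g : LorentzNumber → LorentzNumber} (hf : ContDiffOn ℝ ∞ f V)
    (hg : ContDiffOn ℝ ∞ g V) : ContDiffOn ℝ ∞ (minusSpinor f g) V :=
  (nullSnd.contDiff.comp_contDiffOn hf).prodMk (nullSnd.contDiff.comp_contDiffOn hg)

theorem contDiffOn_tmul {x y : LorentzNumber → ℝ × ℝ} (hx : ContDiffOn ℝ ∞ x V)
    (hy : ContDiffOn ℝ ∞ y V) : ContDiffOn ℝ ∞ (fun z => tmul (x z) (y z)) V :=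
  (tmul.contDiff.comp_contDiffOn hx).clm_apply hy

theorem contDiffOn_area {x y : LorentzNumber → ℝ × ℝ} (hx : ContDiffOn ℝ ∞ x V)
    (hy : ContDiffOn ℝ ∞ y V) : ContDiffOn ℝ ∞ (fun z => area (x z) (y z)) V :=
  ((contDiff_fst.comp_contDiffOn hx).mul (contDiff_snd.comp_contDiffOn hy)).sub
    ((contDiff_snd.comp_contDiffOn hx).mul (contDiff_fst.comp_contDiffOn hy))

theorem fderiv_tmul {x y : LorentzNumber → ℝ × ℝ} (hV : IsOpen V) (hx : ContDiffOn ℝ ∞ x V)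
    (hy : ContDiffOn ℝ ∞ y V) (hz : z ∈ V) (X : LorentzNumber) :
    fderiv ℝ (fun z => tmul (x z) (y z)) z X =
      tmul (fderiv ℝ x z X) (y z) + tmul (x z) (fderiv ℝ y z X) := by
  rw [(tmul.hasFDerivAt_of_bilinear (hx.hasFDerivAt hV hz) (hy.hasFDerivAt hV hz)).fderiv]
  simp [add_comm]

theorem fderiv_prodMk_apply {f g : LorentzNumber → ℝ} {X : LorentzNumber}
    (hf : DifferentiableAt ℝ f z) (hg : DifferentiableAt ℝ g z) :
    fderiv ℝ (fun w => (f w, g w)) z X = (fderiv ℝ f z X, fderiv ℝ g z X) := by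
  rw [(hf.hasFDerivAt.prodMk hg.hasFDerivAt).fderiv]; rfl

theorem continuousOn_spinorForm (h₁ : ContDiffOn ℝ ∞ φ₁ V) (h₂ : ContDiffOn ℝ ∞ φ₂ V)
    (h₃ : ContDiffOn ℝ ∞ ψ₁ V) (h₄ : ContDiffOn ℝ ∞ ψ₂ V) :
    ContinuousOn (spinorForm φ₁ φ₂ ψ₁ ψ₂) V := by
  have hP := contDiffOn_tmul (contDiffOn_plusSpinor h₃ h₄) (contDiffOn_minusSpinor h₁ h₂)
  have hQ := contDiffOn_tmul (contDiffOn_plusSpinor h₁ h₂) (contDiffOn_minusSpinor h₃ h₄)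
  exact ((ContinuousLinearMap.smulRightL ℝ LorentzNumber R22 nullFst).continuous.comp_continuousOn
    hP.continuousOn).add
    ((ContinuousLinearMap.smulRightL ℝ LorentzNumber R22 nullSnd).continuous.comp_continuousOn
      hQ.continuousOn)

/-- A primitive of the spinor form satisfies all four integral formulas: their integrands are fixed
linear combinations of the coordinates of that form. -/
theorem isIntegral_of_hasFDerivAt (h₁ : ContDiffOn ℝ ∞ φ₁ V) (h₂ : ContDiffOn ℝ ∞ φ₂ V)
    (h₃ : ContDiffOn ℝ ∞ ψ₁ V) (h₄ : ContDiffOn ℝ ∞ ψ₂ V)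
    (hF : ∀ z ∈ V, HasFDerivAt F (spinorForm φ₁ φ₂ ψ₁ ψ₂ z) z) (z₀ : LorentzNumber) :
    IsIntegral V z₀ φ₁ φ₂ ψ₁ ψ₂ F := by
  intro z γ hγ hγV
  have key : ∀ (L : R22 →L[ℝ] LorentzNumber) (P Q : LorentzNumber → LorentzNumber),
      (∀ w X, L (spinorForm φ₁ φ₂ ψ₁ ψ₂ w X) = P w * X + Q w * star X) →
      curveIntegral (fun w => formDa (P w) (Q w)) γ = L (F z - F z₀) := by
    intro L P Q h
    have e : (fun w => formDa (P w) (Q w)) = fun w => L.comp (spinorForm φ₁ φ₂ ψ₁ ψ₂ w) := by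
      funext w
      ext1 X
      exact (h w X).symm
    rw [e, curveIntegral_eq_sub_of_piecewiseC1 (f := fun w => L (F w))
      (fun w hw => L.hasFDerivAt.comp w (hF w hw))
      (continuousOn_const.clm_comp (continuousOn_spinorForm h₁ h₂ h₃ h₄)) hγ hγV, map_sub]
  let comb : Fin 4 → Fin 4 → LorentzNumber → LorentzNumber → R22 →L[ℝ] LorentzNumber :=
    fun i j a b => (ContinuousLinearMap.proj (R := ℝ) (φ := fun _ : Fin 4 => ℝ) i).smulRight a +
      (ContinuousLinearMap.proj (R := ℝ) (φ := fun _ : Fin 4 => ℝ) j).smulRight b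
  have hcomb : ∀ i j a b (x : R22), comb i j a b x = x i • a + x j • b := fun i j a b x => rfl
  rw [key (comb 0 1 (-1) (-1)) _ _ ?_, key (comb 0 1 1 (-1)) _ _ ?_,
    key (comb 2 3 1 sigma) _ _ ?_, key (comb 2 3 1 (-sigma)) _ _ ?_]
  · simp only [hcomb]
    refine ⟨?_, ?_, ?_, ?_⟩ <;> apply ext_null <;> simp <;> ring
  all_goals
    intro w X
    simp only [hcomb, spinorForm_apply]
    apply ext_null <;> simp [plusSpinor, minusSpinor] <;> ring

/-- The integral formulas along segments determine the map. -/
theorem IsIntegral.eq_of_univ {z₀ : LorentzNumber} {F F' : LorentzNumber → R22}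
    (h : IsIntegral univ z₀ φ₁ φ₂ ψ₁ ψ₂ F) (h' : IsIntegral univ z₀ φ₁ φ₂ ψ₁ ψ₂ F')
    (h₀ : F z₀ = F' z₀) : F = F' := by
  funext z
  obtain ⟨a1, a2, a3, a4⟩ := h z _ (piecewiseC1_segment z₀ z) fun _ => mem_univ _
  obtain ⟨b1, b2, b3, b4⟩ := h' z _ (piecewiseC1_segment z₀ z) fun _ => mem_univ _
  have c1 := congrArg nullFst (a1.trans b1.symm)
  have c2 := congrArg nullFst (a2.trans b2.symm)
  have c3 := congrArg nullFst (a3.trans b3.symm)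
  have c4 := congrArg nullFst (a4.trans b4.symm)
  simp [h₀] at c1 c2 c3 c4
  ext i
  fin_cases i <;> simp <;> linarith

/-- The Dirac system in null components. -/
theorem IsData.fderiv_spinor (hV : IsOpen V) (h : IsData V φ₁ φ₂ ψ₁ ψ₂ p q) (hz : z ∈ V) :
    fderiv ℝ (plusSpinor φ₁ φ₂) z vecFst = -(p z • plusSpinor ψ₁ ψ₂ z) ∧
    fderiv ℝ (minusSpinor φ₁ φ₂) z vecSnd = -(p z • minusSpinor ψ₁ ψ₂ z) ∧
    fderiv ℝ (plusSpinor ψ₁ ψ₂) z vecSnd = -(q z • plusSpinor φ₁ φ₂ z) ∧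
    fderiv ℝ (minusSpinor ψ₁ ψ₂) z vecFst = -(q z • minusSpinor φ₁ φ₂ z) := by
  have hd : ∀ {f : LorentzNumber → LorentzNumber}, ContDiffOn ℝ ∞ f V → DifferentiableAt ℝ f z :=
    fun hf => (hf.hasFDerivAt hV hz).differentiableAt
  have hp : ∀ {f : LorentzNumber → LorentzNumber}, ContDiffOn ℝ ∞ f V →
      DifferentiableAt ℝ (fun w => nullFst (f w)) z := fun hf =>
          nullFst.differentiableAt.comp z (hd hf)
  have hm : ∀ {f : LorentzNumber → LorentzNumber}, ContDiffOn ℝ ∞ f V →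
      DifferentiableAt ℝ (fun w => nullSnd (f w)) z := fun hf =>
          nullSnd.differentiableAt.comp z (hd hf)
  obtain ⟨a1, a2⟩ := (partialA_eq_iff (hd h.smooth_φ₁)).1 (h.dirac_φ₁ z hz)
  obtain ⟨b1, b2⟩ := (partialA_eq_iff (hd h.smooth_φ₂)).1 (h.dirac_φ₂ z hz)
  obtain ⟨c1, c2⟩ := (partialAHat_eq_iff (hd h.smooth_ψ₁)).1 (h.dirac_ψ₁ z hz)
  obtain ⟨d1, d2⟩ := (partialAHat_eq_iff (hd h.smooth_ψ₂)).1 (h.dirac_ψ₂ z hz)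
  unfold plusSpinor minusSpinor
  rw [fderiv_prodMk_apply (hp h.smooth_φ₁) (hp h.smooth_φ₂),
    fderiv_prodMk_apply (hp h.smooth_ψ₁) (hp h.smooth_ψ₂),
    fderiv_prodMk_apply (hm h.smooth_φ₁) (hm h.smooth_φ₂),
    fderiv_prodMk_apply (hm h.smooth_ψ₁) (hm h.smooth_ψ₂), a1, a2, b1, b2, c1, c2, d1, d2]
  simp

/-- The two mixed null derivatives of the surface, read off the Dirac system, agree; that is, the
spinor form is closed. -/
theorem IsData.fderiv_tmul (hV : IsOpen V) (h : IsData V φ₁ φ₂ ψ₁ ψ₂ p q) (hz : z ∈ V) :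
    fderiv ℝ (fun z => tmul (plusSpinor ψ₁ ψ₂ z) (minusSpinor φ₁ φ₂ z)) z vecSnd =
      -(q z • tmul (plusSpinor φ₁ φ₂ z) (minusSpinor φ₁ φ₂ z)
        + p z • tmul (plusSpinor ψ₁ ψ₂ z) (minusSpinor ψ₁ ψ₂ z)) ∧
    fderiv ℝ (fun z => tmul (plusSpinor φ₁ φ₂ z) (minusSpinor ψ₁ ψ₂ z)) z vecFst =
      -(q z • tmul (plusSpinor φ₁ φ₂ z) (minusSpinor φ₁ φ₂ z)
        + p z • tmul (plusSpinor ψ₁ ψ₂ z) (minusSpinor ψ₁ ψ₂ z)) := by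
  obtain ⟨h1, h2, h3, h4⟩ := h.fderiv_spinor hV hz
  have sp := contDiffOn_plusSpinor h.smooth_φ₁ h.smooth_φ₂
  have sm := contDiffOn_minusSpinor h.smooth_φ₁ h.smooth_φ₂
  have tp := contDiffOn_plusSpinor h.smooth_ψ₁ h.smooth_ψ₂
  have tm := contDiffOn_minusSpinor h.smooth_ψ₁ h.smooth_ψ₂
  rw [Weierstrass.fderiv_tmul hV tp sm hz, Weierstrass.fderiv_tmul hV sp tm hz, h1, h2, h3, h4]
  constructor
  · simp; abel
  · simp

/-- The geometry of a primitive of the spinor form. The mean curvature vector is a multiple of the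
mixed null derivative `-(q B ⊗ C + p A ⊗ E)`, where `A ⊗ C` and `B ⊗ E` are the null derivatives;
it is orthogonal to both, and its square is `p q` times the density. -/
theorem hasGeometry_of_hasFDerivAt (hV : IsOpen V) (h : IsData V φ₁ φ₂ ψ₁ ψ₂ p q)
    (hF : ∀ z ∈ V, HasFDerivAt F (spinorForm φ₁ φ₂ ψ₁ ψ₂ z) z) :
    HasGeometry V φ₁ φ₂ ψ₁ ψ₂ p q F := by
  have sp := contDiffOn_plusSpinor h.smooth_φ₁ h.smooth_φ₂
  have sm := contDiffOn_minusSpinor h.smooth_φ₁ h.smooth_φ₂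
  have tp := contDiffOn_plusSpinor h.smooth_ψ₁ h.smooth_ψ₂
  have tm := contDiffOn_minusSpinor h.smooth_ψ₁ h.smooth_ψ₂
  have sP := contDiffOn_tmul tp sm
  have sQ := contDiffOn_tmul sp tm
  have hFd : ∀ z ∈ V, fderiv ℝ F z = spinorForm φ₁ φ₂ ψ₁ ψ₂ z := fun z hz => (hF z hz).fderiv
  have hmetric : ∀ z ∈ V, ∀ X Y : LorentzNumber,
      ip (fderiv ℝ F z X) (fderiv ℝ F z Y) = -density φ₁ φ₂ ψ₁ ψ₂ z * daDaHat X Y := by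
    intro z hz X Y
    rw [hFd z hz, spinorForm_apply, spinorForm_apply, density_eq, daDaHat_eq]
    simp only [ip_add_left, ip_add_right, ip_smul_left, ip_smul_right, ip_tmul]
    simp only [area]
    ring
  refine ⟨?_, fun z hz => ?_, hmetric, fun z hz => ?_⟩
  · rw [contDiffOn_infty_iff_fderiv_of_isOpen hV]
    refine ⟨fun z hz => (hF z hz).differentiableAt.differentiableWithinAt, ?_⟩
    refine ContDiffOn.congr (f := spinorForm φ₁ φ₂ ψ₁ ψ₂) ?_ hFd
    exact ((ContinuousLinearMap.smulRightL ℝ LorentzNumber R22 nullFst).contDiff.comp_contDiffOn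
      sP).add ((ContinuousLinearMap.smulRightL ℝ LorentzNumber R22 nullSnd).contDiff.comp_contDiffOn
          sQ)
  · rw [injective_iff_map_eq_zero]
    intro X hX
    have hD := h.density_ne_zero z hz
    have h1 := hmetric z hz X vecFst
    have h2 := hmetric z hz X vecSnd
    rw [hX, daDaHat_eq] at h1 h2
    have h0 : ∀ y : R22, ip 0 y = 0 := fun y => by simp [ip]
    simp [h0, hD] at h1 h2
    exact ext_null (by simpa using h2) (by simpa using h1)
  · set D := density φ₁ φ₂ ψ₁ ψ₂ z with hDdef
    have hD : D ≠ 0 := h.density_ne_zero z hz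
    set P := fun z => tmul (plusSpinor ψ₁ ψ₂ z) (minusSpinor φ₁ φ₂ z) with hP
    set Q := fun z => tmul (plusSpinor φ₁ φ₂ z) (minusSpinor ψ₁ ψ₂ z) with hQ
    have hT : ∀ w ∈ V, tangentVec F w 0 = P w + Q w ∧ tangentVec F w 1 = P w - Q w := by
      intro w hw
      simp only [tangentVec, coordVec, hFd w hw, spinorForm_apply, Matrix.cons_val_zero,
        Matrix.cons_val_one, nullFst_one, nullSnd_one, nullFst_sigma, nullSnd_sigma, one_smul,
        neg_smul,
        ← sub_eq_add_neg]
      exact ⟨rfl, rfl⟩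
    obtain ⟨hT0, hT1⟩ := hT z hz
    have hPd := sP.hasFDerivAt hV hz
    have hQd := sQ.hasFDerivAt hV hz
    have hgram : gram F z = !![-D, 0; 0, D] := by
      ext i j
      fin_cases i <;> fin_cases j <;>
        simp [gram, tangentVec, coordVec, hmetric z hz, daDaHat_eq, ← hDdef]
    have hinv : (gram F z)⁻¹ = !![-D⁻¹, 0; 0, D⁻¹] := by
      rw [hgram]
      apply Matrix.inv_eq_right_inv
      ext i j
      fin_cases i <;> fin_cases j <;> simp [hD]
    have hS1 : fderiv ℝ (fun w => tangentVec F w 0) z 1 = fderiv ℝ P z 1 + fderiv ℝ Q z 1 := by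
      have : fderiv ℝ (fun w => tangentVec F w 0) z = fderiv ℝ P z + fderiv ℝ Q z := by
        rw [Filter.EventuallyEq.fderiv_eq (f := fun w => P w + Q w)]
        · exact (hPd.add hQd).fderiv
        · filter_upwards [hV.mem_nhds hz] with w hw using (hT w hw).1
      rw [this]; rfl
    have hS2 : fderiv ℝ (fun w => tangentVec F w 1) z sigma =
        fderiv ℝ P z sigma - fderiv ℝ Q z sigma := by
      have : fderiv ℝ (fun w => tangentVec F w 1) z = fderiv ℝ P z - fderiv ℝ Q z := by
        rw [Filter.EventuallyEq.fderiv_eq (f := fun w => P w - Q w)]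
        · exact (hPd.sub hQd).fderiv
        · filter_upwards [hV.mem_nhds hz] with w hw using (hT w hw).2
      rw [this]; rfl
    obtain ⟨hS3, hS4⟩ := h.fderiv_tmul hV hz
    -- `F_uu - F_vv` is four times the mixed null derivative, which is normal to the surface.
    set S := -(q z • tmul (plusSpinor φ₁ φ₂ z) (minusSpinor φ₁ φ₂ z)
        + p z • tmul (plusSpinor ψ₁ ψ₂ z) (minusSpinor ψ₁ ψ₂ z)) with hS
    have hdiff : fderiv ℝ (fun w => tangentVec F w 0) z 1 -
        fderiv ℝ (fun w => tangentVec F w 1) z sigma = (4 : ℝ) • S := by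
      rw [hS1, hS2, map_eq_null (fderiv ℝ P z) 1, map_eq_null (fderiv ℝ Q z) 1,
        map_eq_null (fderiv ℝ P z) sigma, map_eq_null (fderiv ℝ Q z) sigma, hS3, hS4]
      simp only [nullFst_one, nullSnd_one, nullFst_sigma, nullSnd_sigma]
      module
    have hSP : ip S (P z) = 0 := by
      simp only [hS, hP, ← neg_one_smul ℝ (_ + _ : R22), ip_add_left, ip_smul_left, ip_tmul, area]
      ring
    have hSQ : ip S (Q z) = 0 := by
      simp only [hS, hQ, ← neg_one_smul ℝ (_ + _ : R22), ip_add_left, ip_smul_left, ip_tmul, area]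
      ring
    have hSS : ip S S = p z * q z * D := by
      rw [hDdef, density_eq]
      simp only [hS, ← neg_one_smul ℝ (_ + _ : R22), ip_add_left, ip_add_right, ip_smul_left,
        ip_smul_right, ip_tmul, area]
      ring
    have hH : meanCurvature F z = (-2 * D⁻¹) • S := by
      set U := fderiv ℝ (fun w => tangentVec F w 0) z 1 with hU
      set W := fderiv ℝ (fun w => tangentVec F w 1) z sigma with hW
      have hUW : U = W + (4 : ℝ) • S := by rw [← hdiff]; abel
      have e0 : secondFF F z 0 0 = normalPart F z U := rfl
      have e1 : secondFF F z 1 1 = normalPart F z W := rfl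
      have e2 : normalPart F z U = normalPart F z W + (4 : ℝ) • S := by
        simp only [normalPart, hinv, Fin.sum_univ_two, hT0, hT1, hUW]
        have i1 : ip (W + (4 : ℝ) • S) (P z + Q z) = ip W (P z + Q z) := by
          rw [ip_add_left, ip_smul_left, ip_add_right S, hSP, hSQ]; ring
        have i2 : ip (W + (4 : ℝ) • S) (P z - Q z) = ip W (P z - Q z) := by
          rw [ip_add_left, ip_smul_left, sub_eq_add_neg, ip_add_right S, ← neg_one_smul ℝ,
            ip_smul_right, hSP, hSQ]; ring
        rw [i1, i2]
        abel
      simp only [meanCurvature, Fin.sum_univ_two, hinv, e0, e1, e2]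
      simp
      module
    rw [hH, ip_smul_left, ip_smul_right, hSS]
    field_simp
    ring

/-- The spinor form of global data is closed, hence has a primitive on the plane. -/
theorem exists_hasFDerivAt_spinorForm (h : IsData univ φ₁ φ₂ ψ₁ ψ₂ p q) (z₀ : LorentzNumber)
    (c : R22) :
    ∃ F : LorentzNumber → R22, F z₀ = c ∧ ∀ z, HasFDerivAt F (spinorForm φ₁ φ₂ ψ₁ ψ₂ z) z := by
  have sp := contDiffOn_plusSpinor h.smooth_φ₁ h.smooth_φ₂
  have sm := contDiffOn_minusSpinor h.smooth_φ₁ h.smooth_φ₂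
  have tp := contDiffOn_plusSpinor h.smooth_ψ₁ h.smooth_ψ₂
  have tm := contDiffOn_minusSpinor h.smooth_ψ₁ h.smooth_ψ₂
  obtain ⟨F, hF, hF'⟩ := exists_potential_of_slices nullEquiv isOpen_univ
    (fun s => by
      have : {z ∈ (univ : Set LorentzNumber) | (nullEquiv z).1 = s} =
          (fun t : ℝ => nullEquiv.symm (s, t)) '' univ := by
        ext z
        constructor
        · rintro ⟨-, rfl⟩
          exact ⟨nullSnd z, mem_univ _, nullEquiv.symm_apply_apply z⟩
        · rintro ⟨t, -, rfl⟩
          simp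
      rw [this]
      exact isPreconnected_univ.image _ (by fun_prop))
    isPreconnected_univ (contDiffOn_tmul tp sm) (contDiffOn_tmul sp tm)
    (fun z hz => by
      obtain ⟨h1, h2⟩ := h.fderiv_tmul isOpen_univ hz
      exact h1.trans h2.symm)
  refine ⟨fun z => F z + (c - F z₀), by simp, fun z => ?_⟩
  have h1 := (hF.hasFDerivAt isOpen_univ (mem_univ z)).add_const (c - F z₀)
  have h2 : spinorForm φ₁ φ₂ ψ₁ ψ₂ z = fderiv ℝ F z := by
    ext1 X
    obtain ⟨e1, e2⟩ := hF' z (mem_univ z)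
    rw [map_eq_null (fderiv ℝ F z) X, spinorForm_apply, ← e1, ← e2]
    rfl
  rw [h2]
  exact h1

end

end Weierstrass

/-! ### From surfaces to spinors -/

namespace Weierstrass

noncomputable section

open LorentzNumber R22

variable {V : Set LorentzNumber}

/-- The metric of `ℝ^{2,2}` as a continuous bilinear form. -/
def ipL : R22 →L[ℝ] R22 →L[ℝ] ℝ :=
  LinearMap.toContinuousBilinearMap (LinearMap.mk₂ ℝ ip ip_add_left ip_smul_left
    ip_add_right ip_smul_right)

theorem ipL_apply (x y : R22) : ipL x y = ip x y := rfl

/-- A field of null vectors is orthogonal to its derivatives. -/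
theorem ip_fderiv_self {G : LorentzNumber → R22} (hV : IsOpen V) (hG : ContDiffOn ℝ ∞ G V)
    (h : ∀ z ∈ V, ip (G z) (G z) = 0) {z : LorentzNumber} (hz : z ∈ V) (v : LorentzNumber) :
    ip (fderiv ℝ G z v) (G z) = 0 := by
  have h1 := ipL.hasFDerivAt_of_bilinear (hG.hasFDerivAt hV hz) (hG.hasFDerivAt hV hz)
  have h2 : HasFDerivAt (fun y => ipL (G y) (G y)) (0 : LorentzNumber →L[ℝ] ℝ) z := by
    refine (hasFDerivAt_const (0 : ℝ) z).congr_of_eventuallyEq ?_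
    filter_upwards [hV.mem_nhds hz] with w hw using h w hw
  have h3 := DFunLike.congr_fun (h1.unique h2) v
  simp [ipL_apply] at h3
  rw [ip_comm (G z)] at h3
  linarith

theorem eq_tmul {P : R22} {x y : ℝ × ℝ} (h₁ : x.1 * y.1 = -(P 0 + P 1))
    (h₂ : x.1 * y.2 = P 2 + P 3) (h₃ : x.2 * y.1 = P 2 - P 3) (h₄ : x.2 * y.2 = P 0 - P 1) :
    P = tmul x y := by
  ext i
  fin_cases i <;> simp <;> linarith

/-- A nowhere vanishing null vector field is globally a rank one tensor of smooth spinors. If `P = x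
⊗ y` and `W` is the sum of the squares of the two columns of the matrix of `P`, read as complex
numbers, then `W = |y|² (x₁ + i x₂)²`. Hence `W ≠ 0`, a complex square root of `W` is a multiple of
`x`, and it exists smoothly because `W` has a logarithm. -/
theorem exists_tmul_eq (hV : IsOpen V) (hnc : NullConvex V) {P : LorentzNumber → R22}
    (hP : ContDiffOn ℝ ∞ P V) (hnull : ∀ z ∈ V, ip (P z) (P z) = 0) (hne : ∀ z ∈ V, P z ≠ 0) :
    ∃ x y : LorentzNumber → ℝ × ℝ, ContDiffOn ℝ ∞ x V ∧ ContDiffOn ℝ ∞ y V ∧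
      ∀ z ∈ V, P z = tmul (x z) (y z) := by
  have hPi : ∀ i, ContDiffOn ℝ ∞ (fun z => P z i) V := fun i => contDiffOn_pi.1 hP i
  let a : LorentzNumber → ℝ := fun z => -(P z 0 + P z 1)
  let b : LorentzNumber → ℝ := fun z => P z 2 + P z 3
  let c : LorentzNumber → ℝ := fun z => P z 2 - P z 3
  let d : LorentzNumber → ℝ := fun z => P z 0 - P z 1
  have ha : ContDiffOn ℝ ∞ a V := ((hPi 0).add (hPi 1)).neg
  have hb : ContDiffOn ℝ ∞ b V := (hPi 2).add (hPi 3)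
  have hc : ContDiffOn ℝ ∞ c V := (hPi 2).sub (hPi 3)
  have hd : ContDiffOn ℝ ∞ d V := (hPi 0).sub (hPi 1)
  have hdet : ∀ z ∈ V, a z * d z - b z * c z = 0 := by
    intro z hz
    have := hnull z hz
    simp only [ip] at this
    simp only [a, b, c, d]
    linarith
  have hS : ∀ z ∈ V, 0 < a z ^ 2 + b z ^ 2 + c z ^ 2 + d z ^ 2 := by
    intro z hz
    by_contra hcon
    have h1 : a z = 0 := by
      nlinarith [sq_nonneg (a z), sq_nonneg (b z), sq_nonneg (c z), sq_nonneg (d z)]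
    have h2 : b z = 0 := by
      nlinarith [sq_nonneg (a z), sq_nonneg (b z), sq_nonneg (c z), sq_nonneg (d z)]
    have h3 : c z = 0 := by
      nlinarith [sq_nonneg (a z), sq_nonneg (b z), sq_nonneg (c z), sq_nonneg (d z)]
    have h4 : d z = 0 := by
      nlinarith [sq_nonneg (a z), sq_nonneg (b z), sq_nonneg (c z), sq_nonneg (d z)]
    simp only [a, b, c, d] at h1 h2 h3 h4
    apply hne z hz
    ext i
    fin_cases i <;> simp <;> linarith
  let W : LorentzNumber → ℂ := fun z =>
    ((a z ^ 2 + b z ^ 2 - c z ^ 2 - d z ^ 2 : ℝ) : ℂ) +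
      ((2 * (a z * c z + b z * d z) : ℝ) : ℂ) * Complex.I
  have hWre : ∀ z, (W z).re = a z ^ 2 + b z ^ 2 - c z ^ 2 - d z ^ 2 := fun z => by
    simp only [W, Complex.add_re, Complex.ofReal_re, Complex.re_ofReal_mul, Complex.I_re]; ring
  have hWim : ∀ z, (W z).im = 2 * (a z * c z + b z * d z) := fun z => by
    simp only [W, Complex.add_im, Complex.ofReal_im, Complex.im_ofReal_mul, Complex.I_im]; ring
  have hW : ContDiffOn ℝ ∞ W V := by
    refine ContDiffOn.add (Complex.ofRealCLM.contDiff.comp_contDiffOn ?_)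
      (ContDiffOn.mul (Complex.ofRealCLM.contDiff.comp_contDiffOn ?_) contDiffOn_const)
    · exact (((ha.pow 2).add (hb.pow 2)).sub (hc.pow 2)).sub (hd.pow 2)
    · exact contDiffOn_const.mul ((ha.mul hc).add (hb.mul hd))
  have hWsq : ∀ z ∈ V,
      (W z).re ^ 2 + (W z).im ^ 2 = (a z ^ 2 + b z ^ 2 + c z ^ 2 + d z ^ 2) ^ 2 := by
    intro z hz
    rw [hWre, hWim]
    linear_combination (-4 * (a z * d z - b z * c z)) * hdet z hz
  have hW0 : ∀ z ∈ V, W z ≠ 0 := by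
    intro z hz h0
    have := hWsq z hz
    rw [h0] at this
    have h2 := hS z hz
    simp at this
    exact (pow_pos h2 2).ne this
  obtain ⟨l, hl, hlW⟩ := exists_smooth_log_of_slices nullEquiv hV hnc.null_add
    hnc.isPreconnected hW hW0
  let w : LorentzNumber → ℂ := fun z => Complex.exp (l z / 2)
  have hw : ContDiffOn ℝ ∞ w V := (hl.mul (contDiffOn_const (c := (2⁻¹ : ℂ)))).cexp
  have hww : ∀ z ∈ V, w z * w z = W z := by
    intro z hz
    rw [← hlW z hz, ← Complex.exp_add]
    congr 1; ring
  have hwr : ContDiffOn ℝ ∞ (fun z => (w z).re) V := Complex.reCLM.contDiff.comp_contDiffOn hw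
  have hwi : ContDiffOn ℝ ∞ (fun z => (w z).im) V := Complex.imCLM.contDiff.comp_contDiffOn hw
  have h1 : ∀ z ∈ V, (w z).re * (w z).re - (w z).im * (w z).im =
      a z ^ 2 + b z ^ 2 - c z ^ 2 - d z ^ 2 := fun z hz => by
    rw [← hWre, ← hww z hz, Complex.mul_re]
  have h2 : ∀ z ∈ V, 2 * ((w z).re * (w z).im) = 2 * (a z * c z + b z * d z) := fun z hz => by
    rw [← hWim, ← hww z hz, Complex.mul_im]; ring
  have h3 : ∀ z ∈ V, (w z).re * (w z).re + (w z).im * (w z).im =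
      a z ^ 2 + b z ^ 2 + c z ^ 2 + d z ^ 2 := by
    intro z hz
    have e1 := h1 z hz
    have e2 := h2 z hz
    have e3 := hdet z hz
    have : ((w z).re * (w z).re + (w z).im * (w z).im) ^ 2 =
        (a z ^ 2 + b z ^ 2 + c z ^ 2 + d z ^ 2) ^ 2 := by
      rw [← hWsq z hz, hWre, hWim, ← e1, ← e2]; ring
    exact (pow_left_inj₀ (add_nonneg (mul_self_nonneg _) (mul_self_nonneg _)) (hS z hz).le
      two_ne_zero).1 this
  have hR : ∀ z ∈ V, (w z).re * (w z).re + (w z).im * (w z).im ≠ 0 := fun z hz => by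
    rw [h3 z hz]; exact (hS z hz).ne'
  -- With `x` chosen, `y` is the contraction of the matrix of `P` with `x`, divided by `|x|²`.
  refine ⟨fun z => ((w z).re, (w z).im),
    fun z => (((w z).re * a z + (w z).im * c z) / ((w z).re * (w z).re + (w z).im * (w z).im),
      ((w z).re * b z + (w z).im * d z) / ((w z).re * (w z).re + (w z).im * (w z).im)),
    hwr.prodMk hwi, ?_, ?_⟩
  · have hRs := (hwr.mul hwr).add (hwi.mul hwi)
    exact ContDiffOn.prodMk (((hwr.mul ha).add (hwi.mul hc)).div hRs hR)
      (((hwr.mul hb).add (hwi.mul hd)).div hRs hR)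
  · intro z hz
    have e1 := h1 z hz
    have e2 := h2 z hz
    have e3 := h3 z hz
    have e4 := hdet z hz
    have e5 := hR z hz
    set r := (w z).re
    set s := (w z).im
    set R := r * r + s * s
    have f1 : r * ((r * a z + s * c z) / R) = a z := by
      field_simp
      rw [e3]
      linear_combination (a z / 2) * (e1 + e3) + (c z / 2) * e2 - d z * e4
    have f2 : r * ((r * b z + s * d z) / R) = b z := by
      field_simp
      rw [e3]
      linear_combination (b z / 2) * (e1 + e3) + (d z / 2) * e2 + c z * e4
    have f3 : s * ((r * a z + s * c z) / R) = c z := by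
      field_simp
      rw [e3]
      linear_combination (c z / 2) * (e3 - e1) + (a z / 2) * e2 + b z * e4
    have f4 : s * ((r * b z + s * d z) / R) = d z := by
      field_simp
      rw [e3]
      linear_combination (d z / 2) * (e3 - e1) + (b z / 2) * e2 - a z * e4
    exact eq_tmul f1 f2 f3 f4

/-- If `(x ⊗ y)_v` is orthogonal to `b ⊗ e`, then a rescaling `x ↦ exp l • x`, `y ↦ exp (-l) • y`,
which leaves `x ⊗ y` unchanged, makes `x_v` a multiple of `b` and `y_v` a multiple of `e`. The first
condition is a linear equation for `l_v`; orthogonality gives the second. -/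
theorem exists_balanced_rescaling (hV : IsOpen V) {v : LorentzNumber}
    (hprim : ∀ α : LorentzNumber → ℝ, ContDiffOn ℝ ∞ α V →
      ∃ l : LorentzNumber → ℝ, ContDiffOn ℝ ∞ l V ∧ ∀ z ∈ V, fderiv ℝ l z v = α z)
    {x y b e : LorentzNumber → ℝ × ℝ} (hx : ContDiffOn ℝ ∞ x V) (hy : ContDiffOn ℝ ∞ y V)
    (hb : ContDiffOn ℝ ∞ b V) (hxb : ∀ z ∈ V, area (x z) (b z) ≠ 0)
    (horth : ∀ z ∈ V, ip (fderiv ℝ (fun z => tmul (x z) (y z)) z v) (tmul (b z) (e z)) = 0) :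
    ∃ l : LorentzNumber → ℝ, ContDiffOn ℝ ∞ l V ∧ ∀ z ∈ V,
      area (fderiv ℝ (fun z => Real.exp (l z) • x z) z v) (b z) = 0 ∧
      area (fderiv ℝ (fun z => Real.exp (-l z) • y z) z v) (e z) = 0 := by
  have hx' := hx.fderiv_apply_const hV v
  obtain ⟨l, hl, hl'⟩ := hprim (fun z => -(area (fderiv ℝ x z v) (b z) / area (x z) (b z)))
    ((contDiffOn_area hx' hb).div (contDiffOn_area hx hb) hxb).neg
  refine ⟨l, hl, fun z hz => ?_⟩
  have hld := hl.hasFDerivAt hV hz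
  have h0 := horth z hz
  rw [fderiv_tmul hV hx hy hz, ip_add_left, ip_tmul, ip_tmul] at h0
  have hne := hxb z hz
  constructor
  · rw [(hld.exp.fun_smul (hx.hasFDerivAt hV hz)).fderiv]
    have : area (fderiv ℝ l z v • x z + fderiv ℝ x z v) (b z) = 0 := by
      rw [hl' z hz]
      have : area (-(area (fderiv ℝ x z v) (b z) / area (x z) (b z)) • x z + fderiv ℝ x z v)
          (b z) = -(area (fderiv ℝ x z v) (b z) / area (x z) (b z)) * area (x z) (b z) +
          area (fderiv ℝ x z v) (b z) := by
        simp [area]; ring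
      rw [this]; field_simp; ring
    simp [area] at this ⊢
    linear_combination Real.exp (l z) * this
  · rw [(hld.fun_neg.exp.fun_smul (hy.hasFDerivAt hV hz)).fderiv]
    have : area (-fderiv ℝ l z v • y z + fderiv ℝ y z v) (e z) = 0 := by
      rw [hl' z hz]
      have : area (-(-(area (fderiv ℝ x z v) (b z) / area (x z) (b z))) • y z + fderiv ℝ y z v)
          (e z) = (area (fderiv ℝ x z v) (b z) / area (x z) (b z)) * area (y z) (e z) +
          area (fderiv ℝ y z v) (e z) := by
        simp [area]; ring
      rw [this]; field_simp; linarith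
    simp [area] at this ⊢
    linear_combination Real.exp (-l z) * this

theorem eq_smul_of_area_eq_zero {a b x : ℝ × ℝ} (hab : area a b ≠ 0) (hx : area x b = 0) :
    x = (area a x / area a b) • b := by
  simp only [area] at *
  ext
  · simp; field_simp; linear_combination a.1 * hx
  · simp; field_simp; linear_combination a.2 * hx

/-- Assembles the Lorentz valued functions from their null components, with `A`, `B` the first
components of `ψ`, `φ` and `E`, `C` the second ones. -/
theorem isData_of_spinors {A B C E : LorentzNumber → ℝ × ℝ} {p q : LorentzNumber → ℝ}
    (hV : IsOpen V) (hA : ContDiffOn ℝ ∞ A V) (hB : ContDiffOn ℝ ∞ B V) (hC : ContDiffOn ℝ ∞ C V)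
    (hE : ContDiffOn ℝ ∞ E V) (hp : ContDiffOn ℝ ∞ p V) (hq : ContDiffOn ℝ ∞ q V)
    (hBp : ∀ z ∈ V, fderiv ℝ B z vecFst = -(p z • A z))
    (hCp : ∀ z ∈ V, fderiv ℝ C z vecSnd = -(p z • E z))
    (hAq : ∀ z ∈ V, fderiv ℝ A z vecSnd = -(q z • B z))
    (hEq : ∀ z ∈ V, fderiv ℝ E z vecFst = -(q z • C z))
    (hAB : ∀ z ∈ V, area (A z) (B z) ≠ 0) (hCE : ∀ z ∈ V, area (C z) (E z) ≠ 0) :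
    IsData V (fun z => ofNull ((B z).1, (C z).1)) (fun z => ofNull ((B z).2, (C z).2))
      (fun z => ofNull ((A z).1, (E z).1)) (fun z => ofNull ((A z).2, (E z).2)) p q := by
  have hs : ∀ {f g : LorentzNumber → ℝ}, ContDiffOn ℝ ∞ f V → ContDiffOn ℝ ∞ g V →
      ContDiffOn ℝ ∞ (fun z => ofNull (f z, g z)) V := fun hf hg =>
    nullEquiv.symm.contDiff.comp_contDiffOn (hf.prodMk hg)
  have s1 : ∀ {f : LorentzNumber → ℝ × ℝ}, ContDiffOn ℝ ∞ f V →
      ContDiffOn ℝ ∞ (fun z => (f z).1) V := fun hf => contDiff_fst.comp_contDiffOn hf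
  have s2 : ∀ {f : LorentzNumber → ℝ × ℝ}, ContDiffOn ℝ ∞ f V →
      ContDiffOn ℝ ∞ (fun z => (f z).2) V := fun hf => contDiff_snd.comp_contDiffOn hf
  have d1 : ∀ {f : LorentzNumber → ℝ × ℝ}, ContDiffOn ℝ ∞ f V → ∀ {z}, z ∈ V → ∀ v,
      fderiv ℝ (fun z => (f z).1) z v = (fderiv ℝ f z v).1 := fun hf _ hz v => by
    rw [(hf.hasFDerivAt hV hz).fst.fderiv]; rfl
  have d2 : ∀ {f : LorentzNumber → ℝ × ℝ}, ContDiffOn ℝ ∞ f V → ∀ {z}, z ∈ V → ∀ v,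
      fderiv ℝ (fun z => (f z).2) z v = (fderiv ℝ f z v).2 := fun hf _ hz v => by
    rw [(hf.hasFDerivAt hV hz).snd.fderiv]; rfl
  have hd : ∀ {f : LorentzNumber → LorentzNumber}, ContDiffOn ℝ ∞ f V → ∀ {z}, z ∈ V →
      DifferentiableAt ℝ f z := fun hf _ hz => (hf.hasFDerivAt hV hz).differentiableAt
  refine ⟨hs (s1 hB) (s1 hC), hs (s2 hB) (s2 hC), hs (s1 hA) (s1 hE), hs (s2 hA) (s2 hE), hp, hq,
    fun z hz => ?_, fun z hz => ?_, fun z hz => ?_, fun z hz => ?_, fun z hz => ?_⟩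
  · rw [partialA_eq_iff (hd (hs (s1 hB) (s1 hC)) hz)]
    simp only [nullFst_ofNull, nullSnd_ofNull, d1 hB hz, d1 hC hz, hBp z hz, hCp z hz]
    simp
  · rw [partialA_eq_iff (hd (hs (s2 hB) (s2 hC)) hz)]
    simp only [nullFst_ofNull, nullSnd_ofNull, d2 hB hz, d2 hC hz, hBp z hz, hCp z hz]
    simp
  · rw [partialAHat_eq_iff (hd (hs (s1 hA) (s1 hE)) hz)]
    simp only [nullFst_ofNull, nullSnd_ofNull, d1 hA hz, d1 hE hz, hAq z hz, hEq z hz]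
    simp
  · rw [partialAHat_eq_iff (hd (hs (s2 hA) (s2 hE)) hz)]
    simp only [nullFst_ofNull, nullSnd_ofNull, d2 hA hz, d2 hE hz, hAq z hz, hEq z hz]
    simp
  · rw [density_eq]
    simp only [plusSpinor, minusSpinor, nullFst_ofNull, nullSnd_ofNull]
    exact neg_ne_zero.2 (mul_ne_zero (hAB z hz) (hCE z hz))

/-- A conformally immersed surface over a null convex set comes from spinor data. The rescaling of
`A` and `C` is found along the lines `u + v = const`, that of `B` and `E` along the lines `u - v =
const`. -/
theorem exists_data (hV : IsOpen V) (hnc : NullConvex V) {f : LorentzNumber → R22}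
    (hf : ContDiffOn ℝ ∞ f V) {ρ : LorentzNumber → ℝ} (hρ : ∀ z ∈ V, ρ z ≠ 0)
    (hmet : ∀ z ∈ V, ∀ X Y : LorentzNumber,
      ip (fderiv ℝ f z X) (fderiv ℝ f z Y) = -ρ z * daDaHat X Y) :
    ∃ (φ₁ φ₂ ψ₁ ψ₂ : LorentzNumber → LorentzNumber) (p q : LorentzNumber → ℝ),
      IsData V φ₁ φ₂ ψ₁ ψ₂ p q ∧ (∀ z ∈ V, HasFDerivAt f (spinorForm φ₁ φ₂ ψ₁ ψ₂ z) z) ∧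
      ∀ z ∈ V, ρ z = density φ₁ φ₂ ψ₁ ψ₂ z := by
  have hP := hf.fderiv_apply_const hV vecFst
  have hQ := hf.fderiv_apply_const hV vecSnd
  have hPQ : ∀ z ∈ V, ip (fderiv ℝ f z vecFst) (fderiv ℝ f z vecSnd) = -ρ z / 2 := fun z hz => by
    rw [hmet z hz, daDaHat_eq]; simp; ring
  have hPP : ∀ z ∈ V, ip (fderiv ℝ f z vecFst) (fderiv ℝ f z vecFst) = 0 := fun z hz => by
    rw [hmet z hz, daDaHat_eq]; simp
  have hQQ : ∀ z ∈ V, ip (fderiv ℝ f z vecSnd) (fderiv ℝ f z vecSnd) = 0 := fun z hz => by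
    rw [hmet z hz, daDaHat_eq]; simp
  have hne : ∀ z ∈ V, fderiv ℝ f z vecFst ≠ 0 ∧ fderiv ℝ f z vecSnd ≠ 0 := by
    intro z hz
    have h1 := hPQ z hz
    have h2 := hρ z hz
    constructor <;> intro h0 <;> rw [h0] at h1 <;> simp [ip] at h1 <;> exact h2 (by linarith)
  have hcomm : ∀ z ∈ V, fderiv ℝ (fun w => fderiv ℝ f w vecFst) z vecSnd =
      fderiv ℝ (fun w => fderiv ℝ f w vecSnd) z vecFst := fun z hz =>
          hf.fderiv_apply_comm hV hz vecFst vecSnd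
  obtain ⟨A₀, C₀, hA₀, hC₀, hP₀⟩ := exists_tmul_eq hV hnc hP hPP fun z hz => (hne z hz).1
  obtain ⟨B₀, E₀, hB₀, hE₀, hQ₀⟩ := exists_tmul_eq hV hnc hQ hQQ fun z hz => (hne z hz).2
  have hprod : ∀ z ∈ V, area (A₀ z) (B₀ z) * area (C₀ z) (E₀ z) = -ρ z := by
    intro z hz
    have := hPQ z hz
    rw [hP₀ z hz, hQ₀ z hz, ip_tmul] at this
    linarith
  have hprod' : ∀ z ∈ V, area (A₀ z) (B₀ z) ≠ 0 ∧ area (C₀ z) (E₀ z) ≠ 0 := by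
    intro z hz
    apply mul_ne_zero_iff.1
    rw [hprod z hz]
    exact neg_ne_zero.2 (hρ z hz)
  have hswap : ∀ a b, area b a = -area a b := fun a b => by simp only [area]; ring
  have hPfd : ∀ z ∈ V, fderiv ℝ (fun z => tmul (A₀ z) (C₀ z)) z =
      fderiv ℝ (fun w => fderiv ℝ f w vecFst) z := fun z hz =>
    Filter.EventuallyEq.fderiv_eq (by
      filter_upwards [hV.mem_nhds hz] with w hw using (hP₀ w hw).symm)
  have hQfd : ∀ z ∈ V, fderiv ℝ (fun z => tmul (B₀ z) (E₀ z)) z =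
      fderiv ℝ (fun w => fderiv ℝ f w vecSnd) z := fun z hz =>
    Filter.EventuallyEq.fderiv_eq (by
      filter_upwards [hV.mem_nhds hz] with w hw using (hQ₀ w hw).symm)
  obtain ⟨l, hl, hl'⟩ := exists_balanced_rescaling (v := vecSnd) hV
    (fun α hα => exists_primitive_of_slices nullEquiv hV hnc.null_add hα) hA₀ hC₀ hB₀ (e := E₀)
    (fun z hz => (hprod' z hz).1) (fun z hz => by
      rw [hPfd z hz, hcomm z hz, ← hQ₀ z hz]
      exact ip_fderiv_self hV hQ hQQ hz vecFst)
  obtain ⟨m, hm, hm'⟩ := exists_balanced_rescaling (v := vecFst) hV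
    (fun α hα => exists_primitive_of_slices nullEquiv' hV hnc.null_sub hα) hB₀ hE₀ hA₀ (e := C₀)
    (fun z hz => by rw [hswap]; exact neg_ne_zero.2 (hprod' z hz).1) (fun z hz => by
      rw [hQfd z hz, ← hcomm z hz, ← hP₀ z hz]
      exact ip_fderiv_self hV hP hPP hz vecSnd)
  let A : LorentzNumber → ℝ × ℝ := fun z => Real.exp (l z) • A₀ z
  let C : LorentzNumber → ℝ × ℝ := fun z => Real.exp (-l z) • C₀ z
  let B : LorentzNumber → ℝ × ℝ := fun z => Real.exp (m z) • B₀ z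
  let E : LorentzNumber → ℝ × ℝ := fun z => Real.exp (-m z) • E₀ z
  have hA : ContDiffOn ℝ ∞ A V := hl.exp.smul hA₀
  have hC : ContDiffOn ℝ ∞ C V := hl.neg.exp.smul hC₀
  have hB : ContDiffOn ℝ ∞ B V := hm.exp.smul hB₀
  have hE : ContDiffOn ℝ ∞ E V := hm.neg.exp.smul hE₀
  have hPt : ∀ z ∈ V, fderiv ℝ f z vecFst = tmul (A z) (C z) := by
    intro z hz
    simp only [hP₀ z hz, A, C, map_smul, smul_apply, smul_smul, ← Real.exp_add]
    simp
  have hQt : ∀ z ∈ V, fderiv ℝ f z vecSnd = tmul (B z) (E z) := by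
    intro z hz
    simp only [hQ₀ z hz, B, E, map_smul, smul_apply, smul_smul, ← Real.exp_add]
    simp
  have hprod2 : ∀ z ∈ V, area (A z) (B z) * area (C z) (E z) = -ρ z := by
    intro z hz
    have := hPQ z hz
    rw [hPt z hz, hQt z hz, ip_tmul] at this
    linarith
  have hprod2' : ∀ z ∈ V, area (A z) (B z) ≠ 0 ∧ area (C z) (E z) ≠ 0 := by
    intro z hz
    apply mul_ne_zero_iff.1
    rw [hprod2 z hz]
    exact neg_ne_zero.2 (hρ z hz)
  have hareas : ∀ (a b : ℝ × ℝ) (r : ℝ), area a b = 0 → area a (r • b) = 0 := fun a b r h => by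
    have : area a (r • b) = r * area a b := by simp [area]; ring
    rw [this, h, mul_zero]
  have kA : ∀ z ∈ V, fderiv ℝ A z vecSnd =
      (area (A z) (fderiv ℝ A z vecSnd) / area (A z) (B z)) • B z :=
    fun z hz => eq_smul_of_area_eq_zero (hprod2' z hz).1 (hareas _ _ _ (hl' z hz).1)
  have kC : ∀ z ∈ V, fderiv ℝ C z vecSnd =
      (area (C z) (fderiv ℝ C z vecSnd) / area (C z) (E z)) • E z :=
    fun z hz => eq_smul_of_area_eq_zero (hprod2' z hz).2 (hareas _ _ _ (hl' z hz).2)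
  have kB : ∀ z ∈ V, fderiv ℝ B z vecFst =
      (area (B z) (fderiv ℝ B z vecFst) / area (B z) (A z)) • A z :=
    fun z hz => eq_smul_of_area_eq_zero (by rw [hswap]; exact neg_ne_zero.2 (hprod2' z hz).1)
      (hareas _ _ _ (hm' z hz).1)
  have kE : ∀ z ∈ V, fderiv ℝ E z vecFst =
      (area (E z) (fderiv ℝ E z vecFst) / area (E z) (C z)) • C z :=
    fun z hz => eq_smul_of_area_eq_zero (by rw [hswap]; exact neg_ne_zero.2 (hprod2' z hz).2)
      (hareas _ _ _ (hm' z hz).2)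
  let q : LorentzNumber → ℝ := fun z => -(area (A z) (fderiv ℝ A z vecSnd) / area (A z) (B z))
  let p : LorentzNumber → ℝ := fun z => -(area (B z) (fderiv ℝ B z vecFst) / area (B z) (A z))
  have hq : ContDiffOn ℝ ∞ q V :=
    ((contDiffOn_area hA (hA.fderiv_apply_const hV vecSnd)).div (contDiffOn_area hA hB)
      fun z hz => (hprod2' z hz).1).neg
  have hp : ContDiffOn ℝ ∞ p V :=
    ((contDiffOn_area hB (hB.fderiv_apply_const hV vecFst)).div (contDiffOn_area hB hA)
      fun z hz => by rw [hswap]; exact neg_ne_zero.2 (hprod2' z hz).1).neg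
  have hAq : ∀ z ∈ V, fderiv ℝ A z vecSnd = -(q z • B z) := fun z hz => by
    rw [kA z hz]; simp only [q, neg_smul, neg_neg]
  have hBp : ∀ z ∈ V, fderiv ℝ B z vecFst = -(p z • A z) := fun z hz => by
    rw [kB z hz]; simp only [p, neg_smul, neg_neg]
  -- Equality of the mixed derivatives forces the two remaining coefficients to be `-p` and `-q`.
  have hmix : ∀ z ∈ V, ∃ c e : ℝ, fderiv ℝ C z vecSnd = c • E z ∧ fderiv ℝ E z vecFst = e • C z ∧
      c = -p z ∧ e = -q z := by
    intro z hz
    refine ⟨_, _, kC z hz, kE z hz, ?_⟩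
    set c := area (C z) (fderiv ℝ C z vecSnd) / area (C z) (E z) with hc
    set e := area (E z) (fderiv ℝ E z vecFst) / area (E z) (C z) with he
    have h1 : fderiv ℝ (fun w => tmul (A w) (C w)) z vecSnd =
        fderiv ℝ (fun w => tmul (B w) (E w)) z vecFst := by
      have e1 : fderiv ℝ (fun w => tmul (A w) (C w)) z =
          fderiv ℝ (fun w => fderiv ℝ f w vecFst) z :=
        Filter.EventuallyEq.fderiv_eq
          (by filter_upwards [hV.mem_nhds hz] with w hw using (hPt w hw).symm)
      have e2 : fderiv ℝ (fun w => tmul (B w) (E w)) z =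
          fderiv ℝ (fun w => fderiv ℝ f w vecSnd) z :=
        Filter.EventuallyEq.fderiv_eq
          (by filter_upwards [hV.mem_nhds hz] with w hw using (hQt w hw).symm)
      rw [e1, e2, hcomm z hz]
    rw [fderiv_tmul hV hA hC hz, fderiv_tmul hV hB hE hz, hAq z hz, hBp z hz, kC z hz, kE z hz,
      ← hc, ← he] at h1
    simp only [map_neg, map_smul, neg_apply, smul_apply] at h1
    have h2 := congrArg (fun y => ip y (tmul (A z) (E z))) h1
    have h3 := congrArg (fun y => ip y (tmul (B z) (C z))) h1
    simp only [← neg_one_smul ℝ (_ • _ : R22), ip_add_left, ip_smul_left, ip_tmul] at h2 h3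
    have e0 : ∀ a, area a a = 0 := fun a => by simp only [area]; ring
    obtain ⟨n1, n2⟩ := hprod2' z hz
    have n3 : area (A z) (B z) * area (C z) (E z) ≠ 0 := mul_ne_zero n1 n2
    rw [e0, e0, hswap (A z) (B z)] at h2
    rw [e0, e0, hswap (C z) (E z)] at h3
    constructor <;> apply mul_right_cancel₀ n3 <;> linarith
  have hCp : ∀ z ∈ V, fderiv ℝ C z vecSnd = -(p z • E z) := fun z hz => by
    obtain ⟨c, e, h1, -, rfl, -⟩ := hmix z hz
    rw [h1, neg_smul]
  have hEq : ∀ z ∈ V, fderiv ℝ E z vecFst = -(q z • C z) := fun z hz => by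
    obtain ⟨c, e, -, h1, -, rfl⟩ := hmix z hz
    rw [h1, neg_smul]
  refine ⟨_, _, _, _, p, q, isData_of_spinors hV hA hB hC hE hp hq hBp hCp hAq hEq
    (fun z hz => (hprod2' z hz).1) (fun z hz => (hprod2' z hz).2), fun z hz => ?_, fun z hz => ?_⟩
  · have h2 : fderiv ℝ f z = spinorForm (fun z => ofNull ((B z).1, (C z).1))
        (fun z => ofNull ((B z).2, (C z).2)) (fun z => ofNull ((A z).1, (E z).1))
        (fun z => ofNull ((A z).2, (E z).2)) z := by
      ext1 X
      rw [map_eq_null (fderiv ℝ f z) X, spinorForm_apply, hPt z hz, hQt z hz]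
      simp [plusSpinor, minusSpinor]
    rw [← h2]
    exact hf.hasFDerivAt hV hz
  · rw [density_eq]
    simp only [plusSpinor, minusSpinor, nullFst_ofNull, nullSnd_ofNull]
    linarith [hprod2 z hz]

end

end Weierstrass

/-! ### Null coordinates -/

section NullCoordinates

open LorentzNumber R22 Weierstrass

/-- The null directions `(1, h)` and `(k, 1)` of the quadratic form `a x² + 2 b x y + c y²` with `b
> 0` and positive discriminant, written so as to depend smoothly on `a`, `b`, `c` also where `a` or
`c` vanishes; they are independent, and their product is positive. -/
theorem null_slopes {a b c : ℝ} (hb : 0 < b) (hd : 0 < b ^ 2 - a * c) {r h k : ℝ}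
    (hr : r = b + √(b ^ 2 - a * c)) (hh : h = -a / r) (hk : k = -c / r) :
    0 < r ∧ a + 2 * b * h + c * h ^ 2 = 0 ∧ c + 2 * b * k + a * k ^ 2 = 0 ∧ 0 < 1 - h * k ∧
      0 < a * k + b * (1 + h * k) + c * h := by
  have hs : 0 < √(b ^ 2 - a * c) := Real.sqrt_pos.2 hd
  have hs2 : √(b ^ 2 - a * c) ^ 2 = b ^ 2 - a * c := Real.sq_sqrt hd.le
  set s := √(b ^ 2 - a * c)
  have hr0 : 0 < r := by rw [hr]; positivity
  have hrs : r - b = s := by rw [hr]; ring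
  have hq : r ^ 2 - 2 * b * r + a * c = 0 := by rw [hr]; linear_combination hs2
  subst hh hk
  refine ⟨hr0, ?_, ?_, ?_, ?_⟩
  · field_simp
    linear_combination a * hq
  · field_simp
    linear_combination c * hq
  · have : 1 - -a / r * (-c / r) = 2 * s / r := by
      rw [← hrs]; field_simp; linear_combination -hq
    rw [this]; positivity
  · have : a * (-c / r) + b * (1 + -a / r * (-c / r)) + c * (-a / r) = 2 * s ^ 2 / r := by
      rw [← hrs]; field_simp; linear_combination (b - 2 * r) * hq
    rw [this]; positivity

/-- A ball for the maximum norm in null coordinates is a square with null sides, hence null convex.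
-/
theorem nullConvex_preimage_ball (x : ℝ × ℝ) (r : ℝ) :
    NullConvex (nullEquiv.symm '' Metric.ball x r) := by
  have hI : ∀ y : ℝ, IsPreconnected (Metric.ball y r) := fun y => (convex_ball y r).isPreconnected
  have hc : ∀ y c : ℝ, IsPreconnected (Metric.ball y r ∩ {c}) := fun y c =>
    (subsingleton_singleton.anti inter_subset_right).isPreconnected
  have hcont : Continuous nullEquiv.symm := nullEquiv.symm.continuous
  rw [← Prod.mk.eta (p := x), ← ball_prod_same]
  refine ⟨((hI _).prod (hI _)).image _ hcont.continuousOn, fun c => ?_, fun c => ?_⟩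
  · convert ((hc x.1 c).prod (hI x.2)).image _ hcont.continuousOn using 1
    ext z
    constructor
    · rintro ⟨⟨y, hy, rfl⟩, h⟩
      exact ⟨y, ⟨⟨hy.1, (nullFst_ofNull y).symm.trans h⟩, hy.2⟩, rfl⟩
    · rintro ⟨y, ⟨⟨h1, h2⟩, h3⟩, rfl⟩
      exact ⟨⟨y, ⟨h1, h3⟩, rfl⟩, (nullFst_ofNull y).trans h2⟩
  · convert ((hI x.1).prod (hc x.2 c)).image _ hcont.continuousOn using 1
    ext z
    constructor
    · rintro ⟨⟨y, hy, rfl⟩, h⟩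
      exact ⟨y, ⟨hy.1, hy.2, (nullSnd_ofNull y).symm.trans h⟩, rfl⟩
    · rintro ⟨y, ⟨h1, h3, h2⟩, rfl⟩
      exact ⟨⟨y, ⟨h1, h3⟩, rfl⟩, (nullSnd_ofNull y).trans h2⟩

/-- Null coordinates: a Lorentzian surface in `ℝ^{2,2}`, parameterized so that the first coordinate
vector at the base point is null, has local conformal parameters. The null coordinates are functions
`s` and `t` constant along the two families of null curves. The signature is not a hypothesis: it
follows from `h11` and `h12`. -/
theorem exists_null_coordinates {f : ℝ × ℝ → R22} {Ω : Set (ℝ × ℝ)} (hΩ : IsOpen Ω)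
    (h0 : (0 : ℝ × ℝ) ∈ Ω) (hf : ContDiffOn ℝ ∞ f Ω)
    (h11 : ip (fderiv ℝ f 0 (1, 0)) (fderiv ℝ f 0 (1, 0)) = 0)
    (h12 : 0 < ip (fderiv ℝ f 0 (1, 0)) (fderiv ℝ f 0 (0, 1))) :
    ∃ (e : OpenPartialHomeomorph (ℝ × ℝ) LorentzNumber) (ρ : LorentzNumber → ℝ),
      0 ∈ e.source ∧ e.source ⊆ Ω ∧ ContDiffOn ℝ ∞ e e.source ∧ ContDiffOn ℝ ∞ e.symm e.target ∧
      NullConvex e.target ∧ (∀ z ∈ e.target, 0 < ρ z) ∧ ∀ z ∈ e.target, ∀ X Y,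
        ip (fderiv ℝ (f ∘ e.symm) z X) (fderiv ℝ (f ∘ e.symm) z Y) = -ρ z * daDaHat X Y := by
  have hip : ∀ {G₁ G₂ : ℝ × ℝ → R22}, ContDiffOn ℝ ∞ G₁ Ω → ContDiffOn ℝ ∞ G₂ Ω →
      ContDiffOn ℝ ∞ (fun z => ip (G₁ z) (G₂ z)) Ω := fun h₁ h₂ =>
    (ipL.contDiff.comp_contDiffOn h₁).clm_apply h₂
  have hf1 := hf.fderiv_apply_const hΩ (1, 0)
  have hf2 := hf.fderiv_apply_const hΩ (0, 1)
  let a : ℝ × ℝ → ℝ := fun z => ip (fderiv ℝ f z (1, 0)) (fderiv ℝ f z (1, 0))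
  let b : ℝ × ℝ → ℝ := fun z => ip (fderiv ℝ f z (1, 0)) (fderiv ℝ f z (0, 1))
  let c : ℝ × ℝ → ℝ := fun z => ip (fderiv ℝ f z (0, 1)) (fderiv ℝ f z (0, 1))
  have ha : ContDiffOn ℝ ∞ a Ω := hip hf1 hf1
  have hb : ContDiffOn ℝ ∞ b Ω := hip hf1 hf2
  have hc : ContDiffOn ℝ ∞ c Ω := hip hf2 hf2
  have hdisc : ContDiffOn ℝ ∞ (fun z => b z ^ 2 - a z * c z) Ω := (hb.pow 2).sub (ha.mul hc)
  let Ω₁ : Set (ℝ × ℝ) := (Ω ∩ b ⁻¹' Ioi 0) ∩ (Ω ∩ (fun z => b z ^ 2 - a z * c z) ⁻¹' Ioi 0)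
  have hΩ₁ : IsOpen Ω₁ := (hb.continuousOn.isOpen_inter_preimage hΩ isOpen_Ioi).inter
    (hdisc.continuousOn.isOpen_inter_preimage hΩ isOpen_Ioi)
  have hsub : Ω₁ ⊆ Ω := fun z hz => hz.1.1
  have h0₁ : (0 : ℝ × ℝ) ∈ Ω₁ := by
    refine ⟨⟨h0, h12⟩, h0, ?_⟩
    have : a 0 = 0 := h11
    simp only [mem_preimage, this, zero_mul, sub_zero, mem_Ioi]
    exact pow_pos h12 2
  let r : ℝ × ℝ → ℝ := fun z => b z + √(b z ^ 2 - a z * c z)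
  let h : ℝ × ℝ → ℝ := fun z => -a z / r z
  let k : ℝ × ℝ → ℝ := fun z => -c z / r z
  have hnull := fun z (hz : z ∈ Ω₁) =>
    null_slopes (a := a z) (c := c z) hz.1.2 hz.2.2 (r := r z) (h := h z) (k := k z) rfl rfl rfl
  have hr : ContDiffOn ℝ ∞ r Ω₁ := (hb.mono hsub).add
    ((hdisc.mono hsub).sqrt fun z hz => (show 0 < b z ^ 2 - a z * c z from hz.2.2).ne')
  have hh : ContDiffOn ℝ ∞ h Ω₁ := (ha.mono hsub).neg.div hr fun z hz => (hnull z hz).1.ne'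
  have hk : ContDiffOn ℝ ∞ k Ω₁ := (hc.mono hsub).neg.div hr fun z hz => (hnull z hz).1.ne'
  obtain ⟨Ut, t, hUt, h0t, ht, ht'⟩ := exists_characteristic_coordinate hΩ₁ h0₁ hh
  let sw : (ℝ × ℝ) ≃L[ℝ] ℝ × ℝ := ContinuousLinearEquiv.prodComm ℝ ℝ ℝ
  obtain ⟨Us, s, hUs, h0s, hs, hs'⟩ := exists_characteristic_coordinate
    (hΩ₁.preimage sw.continuous) h0₁ (hk.comp sw.contDiff.contDiffOn fun _ h => h)
  let Ω₂ : Set (ℝ × ℝ) := Ω₁ ∩ Ut ∩ sw ⁻¹' Us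
  have hΩ₂ : IsOpen Ω₂ := (hΩ₁.inter hUt).inter (hUs.preimage sw.continuous)
  have ht₂ : ContDiffOn ℝ ∞ t Ω₂ := ht.mono fun z hz => hz.1.2
  have hs₂ : ContDiffOn ℝ ∞ (s ∘ sw) Ω₂ := hs.comp sw.contDiff.contDiffOn fun z hz => hz.2
  have hsd : ∀ z v, fderiv ℝ (s ∘ sw) z v = fderiv ℝ s (sw z) (sw v) := fun z v => by
    rw [ContinuousLinearEquiv.comp_right_fderiv]; rfl
  have hbasis : ∀ v : ℝ × ℝ,
      v = v.1 • ((1 : ℝ), (0 : ℝ)) + v.2 • ((0 : ℝ), (1 : ℝ)) := fun v => by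
    ext <;> simp
  have htv : ∀ z ∈ Ω₂, ∀ v : ℝ × ℝ,
      fderiv ℝ t z v = fderiv ℝ t z (0, 1) * (v.2 - h z * v.1) := by
    intro z hz v
    have h1 := (ht' z hz.1.2).1
    rw [hbasis (1, h z)] at h1
    rw [hbasis v]
    simp only [map_add, map_smul, smul_eq_mul] at h1 ⊢
    simp
    linear_combination v.1 * h1
  have hsv : ∀ z ∈ Ω₂, ∀ v : ℝ × ℝ,
      fderiv ℝ (s ∘ sw) z v = fderiv ℝ s (sw z) (0, 1) * (v.1 - k z * v.2) := by
    intro z hz v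
    have h1 := (hs' _ hz.2).1
    have e1 : (k ∘ sw) (sw z) = k z := rfl
    rw [hbasis (1, (k ∘ sw) (sw z)), e1] at h1
    rw [hsd, hbasis (sw v)]
    simp only [map_add, map_smul, smul_eq_mul] at h1 ⊢
    simp [sw] at h1 ⊢
    linear_combination v.2 * h1
  -- The sign of the first coordinate makes `ρ` positive.
  let Φ : ℝ × ℝ → LorentzNumber := fun z => nullEquiv.symm (-(s ∘ sw) z, t z)
  have hΦ : ContDiffOn ℝ ∞ Φ Ω₂ := nullEquiv.symm.contDiff.comp_contDiffOn (hs₂.neg.prodMk ht₂)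
  have hΦd : ∀ z ∈ Ω₂, ∀ v, fderiv ℝ Φ z v =
      ofNull (-fderiv ℝ (s ∘ sw) z v, fderiv ℝ t z v) := by
    intro z hz v
    have h1 : HasFDerivAt Φ _ z := nullEquiv.symm.hasFDerivAt.comp z
      ((hs₂.hasFDerivAt hΩ₂ hz).fun_neg.prodMk (ht₂.hasFDerivAt hΩ₂ hz))
    rw [h1.fderiv]; rfl
  have hinj : ∀ z ∈ Ω₂, Function.Injective (fderiv ℝ Φ z) := by
    intro z hz
    rw [injective_iff_map_eq_zero]
    intro v hv
    rw [hΦd z hz] at hv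
    have h1 : nullFst (ofNull (-fderiv ℝ (s ∘ sw) z v, fderiv ℝ t z v)) = 0 := by rw [hv, map_zero]
    have h2 : nullSnd (ofNull (-fderiv ℝ (s ∘ sw) z v, fderiv ℝ t z v)) = 0 := by rw [hv, map_zero]
    rw [nullFst_ofNull] at h1
    rw [nullSnd_ofNull] at h2
    rw [hsv z hz, neg_eq_zero] at h1
    rw [htv z hz] at h2
    have h3 := (mul_eq_zero.1 h1).resolve_left (hs' _ hz.2).2.ne'
    have h4 := (mul_eq_zero.1 h2).resolve_left (ht' _ hz.1.2).2.ne'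
    have h5 := (hnull z hz.1.1).2.2.2.1
    have h6 : v.2 = 0 := by
      have : (1 - h z * k z) * v.2 = 0 := by linear_combination h z * h3 + h4
      exact (mul_eq_zero.1 this).resolve_left h5.ne'
    have h7 : v.1 = 0 := by rw [h6] at h3; linarith
    exact Prod.ext h7 h6
  obtain ⟨e₀, he0, heΩ, heΦ, hes⟩ := exists_openPartialHomeomorph_of_injective_fderiv
    nullEquiv.symm.toLinearEquiv.finrank_eq hΩ₂ (x₀ := 0) ⟨⟨h0₁, h0t⟩, h0s⟩ hΦ hinj
  obtain ⟨δ, hδ, hball⟩ := Metric.mem_nhds_iff.1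
    ((e₀.open_target.preimage nullEquiv.symm.continuous).mem_nhds
      (show nullEquiv (e₀ 0) ∈ nullEquiv.symm ⁻¹' e₀.target by
        simpa only [mem_preimage, ContinuousLinearEquiv.symm_apply_apply] using e₀.map_source he0))
  -- The target is shrunk to a null convex set.
  let B : Set LorentzNumber := nullEquiv.symm '' Metric.ball (nullEquiv (e₀ 0)) δ
  have hBo : IsOpen B := nullEquiv.symm.isOpenMap _ Metric.isOpen_ball
  have hBt : B ⊆ e₀.target := by
    rintro _ ⟨y, hy, rfl⟩; exact hball hy
  let e : OpenPartialHomeomorph (ℝ × ℝ) LorentzNumber := (e₀.symm.restrOpen B hBo).symm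
  have het : e.target = B := inter_eq_right.2 hBt
  have hesrc : e.source ⊆ e₀.source := by
    intro x hx
    have := (e.map_source hx)
    rw [het] at this
    have h2 := e₀.map_target (hBt this)
    have h3 : e₀.symm (e x) = x := e.left_inv hx
    rwa [h3] at h2
  have hes' : ContDiffOn ℝ ∞ e.symm e.target := hes.mono (by rw [het]; exact hBt)
  have heΦ' : (e : ℝ × ℝ → LorentzNumber) = Φ := funext heΦ
  -- The new null coordinate vectors are multiples of the null directions, with known signs.
  have hmain : ∀ z ∈ e.target, ∃ m₁ m₂ : ℝ, 0 < m₁ ∧ 0 < m₂ ∧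
      m₁ • fderiv ℝ (f ∘ e.symm) z vecFst = -fderiv ℝ f (e.symm z) (1, h (e.symm z)) ∧
      m₂ • fderiv ℝ (f ∘ e.symm) z vecSnd = fderiv ℝ f (e.symm z) (k (e.symm z), 1) := by
    intro z hz
    have hx := heΩ (hesrc (e.map_target hz))
    set x := e.symm z with hxdef
    have hxe : Φ x = z := by rw [← heΦ']; exact e.right_inv hz
    have hpos := (hnull x hx.1.1).2.2.2.1
    have hft : DifferentiableAt ℝ (f ∘ e.symm) z :=
      ((hf.hasFDerivAt hΩ (hsub hx.1.1)).comp z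
        (hes'.hasFDerivAt e.open_target hz)).differentiableAt
    -- `f ∘ e.symm ∘ Φ = f` near `x`.
    have hcomp : (fderiv ℝ (f ∘ e.symm) z).comp (fderiv ℝ Φ x) = fderiv ℝ f x := by
      have h1 : HasFDerivAt ((f ∘ e.symm) ∘ Φ)
          ((fderiv ℝ (f ∘ e.symm) z).comp (fderiv ℝ Φ x)) x := by
        refine HasFDerivAt.comp x ?_ (hΦ.hasFDerivAt hΩ₂ hx)
        rw [hxe]; exact hft.hasFDerivAt
      have h2 : HasFDerivAt ((f ∘ e.symm) ∘ Φ) (fderiv ℝ f x) x := by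
        refine (hf.hasFDerivAt hΩ (hsub hx.1.1)).congr_of_eventuallyEq ?_
        filter_upwards [e.open_source.mem_nhds (e.map_target hz)] with y hy
        rw [Function.comp_apply, ← heΦ', Function.comp_apply, e.left_inv hy]
      exact h1.unique h2
    have hv : ∀ v, fderiv ℝ (f ∘ e.symm) z (fderiv ℝ Φ x v) = fderiv ℝ f x v := fun v =>
      DFunLike.congr_fun hcomp v
    refine ⟨fderiv ℝ s (sw x) (0, 1) * (1 - h x * k x), fderiv ℝ t x (0, 1) * (1 - h x * k x),
      mul_pos (hs' _ hx.2).2 hpos, mul_pos (ht' _ hx.1.2).2 hpos, ?_, ?_⟩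
    · rw [← hv (1, h x), ← map_smul, ← map_neg]
      congr 1
      rw [hΦd x hx, htv x hx (1, h x), hsv x hx (1, h x)]
      apply ext_null <;>
        simp only [nullFst_ofNull, nullSnd_ofNull, map_smul, map_neg, nullFst_vecFst,
          nullSnd_vecFst, smul_eq_mul] <;> ring
    · rw [← hv (k x, 1), ← map_smul]
      congr 1
      rw [hΦd x hx, htv x hx (k x, 1), hsv x hx (k x, 1)]
      apply ext_null <;>
        simp only [nullFst_ofNull, nullSnd_ofNull, map_smul, nullFst_vecSnd, nullSnd_vecSnd,
        smul_eq_mul] <;> ring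
  have hipf : ∀ z (v w : ℝ × ℝ), ip (fderiv ℝ f z v) (fderiv ℝ f z w) =
      v.1 * w.1 * a z + (v.1 * w.2 + v.2 * w.1) * b z + v.2 * w.2 * c z := by
    intro z v w
    rw [hbasis v, hbasis w]
    simp only [map_add, map_smul, ip_add_left, ip_add_right, ip_smul_left, ip_smul_right, a, b, c]
    rw [ip_comm (fderiv ℝ f z (0, 1)) (fderiv ℝ f z (1, 0))]
    simp
    ring
  refine ⟨e, fun z => -2 * ip (fderiv ℝ (f ∘ e.symm) z vecFst) (fderiv ℝ (f ∘ e.symm) z vecSnd), ?_,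
    fun x hx => hsub (heΩ (hesrc hx)).1.1, ?_, hes', ?_, fun z hz => ?_, fun z hz X Y => ?_⟩
  · have hm : e₀ 0 ∈ e.target := by
      rw [het]
      exact ⟨nullEquiv (e₀ 0), Metric.mem_ball_self hδ, nullEquiv.symm_apply_apply _⟩
    have h1 := e.map_target hm
    have h2 : e.symm (e₀ 0) = 0 := e₀.left_inv he0
    rwa [h2] at h1
  · rw [heΦ']
    exact hΦ.mono fun x hx => heΩ (hesrc hx)
  · rw [het]; exact nullConvex_preimage_ball _ _
  · obtain ⟨m₁, m₂, hm₁, hm₂, h1, h2⟩ := hmain z hz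
    have hx := heΩ (hesrc (e.map_target hz))
    have hpos := (hnull _ hx.1.1).2.2.2.2
    have h3 : m₁ * (m₂ * ip (fderiv ℝ (f ∘ e.symm) z vecFst)
        (fderiv ℝ (f ∘ e.symm) z vecSnd)) < 0 := by
      rw [← ip_smul_right, ← ip_smul_left, h1, h2, ← neg_one_smul ℝ, ip_smul_left, hipf]
      simp only
      nlinarith [hpos]
    have h4 := neg_of_mul_neg_right h3 hm₁.le
    have h5 := neg_of_mul_neg_right h4 hm₂.le
    linarith
  · obtain ⟨m₁, m₂, hm₁, hm₂, h1, h2⟩ := hmain z hz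
    have hx := heΩ (hesrc (e.map_target hz))
    obtain ⟨-, n1, n2, -⟩ := hnull _ hx.1.1
    have k1 : ip (fderiv ℝ (f ∘ e.symm) z vecFst) (fderiv ℝ (f ∘ e.symm) z vecFst) = 0 := by
      have : m₁ * (m₁ * ip (fderiv ℝ (f ∘ e.symm) z vecFst)
          (fderiv ℝ (f ∘ e.symm) z vecFst)) = 0 := by
        rw [← ip_smul_right, ← ip_smul_left, h1, ← neg_one_smul ℝ, ip_smul_left, ip_smul_right,
          hipf]
        simp only
        linear_combination n1
      simpa [hm₁.ne'] using this
    have k2 : ip (fderiv ℝ (f ∘ e.symm) z vecSnd) (fderiv ℝ (f ∘ e.symm) z vecSnd) = 0 := by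
      have : m₂ * (m₂ * ip (fderiv ℝ (f ∘ e.symm) z vecSnd)
          (fderiv ℝ (f ∘ e.symm) z vecSnd)) = 0 := by
        rw [← ip_smul_right, ← ip_smul_left, h2, hipf]
        simp only
        linear_combination n2
      simpa [hm₂.ne'] using this
    rw [map_eq_null (fderiv ℝ (f ∘ e.symm) z) X, map_eq_null (fderiv ℝ (f ∘ e.symm) z) Y,
      daDaHat_eq]
    simp only [ip_add_left, ip_add_right, ip_smul_left, ip_smul_right, k1, k2]
    rw [ip_comm (fderiv ℝ (f ∘ e.symm) z vecSnd) (fderiv ℝ (f ∘ e.symm) z vecFst)]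
    ring

end NullCoordinates

/-! ### Conformal charts of Lorentzian surfaces -/

section Surfaces

open LorentzNumber R22 Weierstrass

variable {M : Type*} [TopologicalSpace M] [ChartedSpace (EuclideanSpace ℝ (Fin 2)) M]

section Parameterizations

variable {E : Type*} [NormedAddCommGroup E] [NormedSpace ℝ E] {b : E → M} {V : Set E} {F : M → R22}

theorem contDiffOn_comp_parameterization (hF : ContMDiff (𝓡 2) 𝓘(ℝ, R22) ∞ F)
    (hb : ContMDiffOn 𝓘(ℝ, E) (𝓡 2) ∞ b V) : ContDiffOn ℝ ∞ (F ∘ b) V :=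
  (hF.comp_contMDiffOn hb).contDiffOn

theorem fderiv_comp_parameterization (hF : ContMDiff (𝓡 2) 𝓘(ℝ, R22) ∞ F) (hV : IsOpen V)
    (hb : ContMDiffOn 𝓘(ℝ, E) (𝓡 2) ∞ b V) {z : E} (hz : z ∈ V) (X : E) :
    fderiv ℝ (F ∘ b) z X =
      mfderiv (𝓡 2) 𝓘(ℝ, R22) F (b z) (mfderiv 𝓘(ℝ, E) (𝓡 2) b z X) := by
  rw [← mfderiv_eq_fderiv, mfderiv_comp z (hF.mdifferentiable (by simp) _)
    ((hb.contMDiffAt (hV.mem_nhds hz)).mdifferentiableAt (by simp))]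
  rfl

variable [IsManifold (𝓡 2) ∞ M] {g : LorentzianMetric M}

/-- The metric of `M` in a parameterization, computed in `ℝ^{2,2}`. -/
theorem IsIsometricImmersion.ip_fderiv_comp (hF : IsIsometricImmersion g F) (hV : IsOpen V)
    (hb : ContMDiffOn 𝓘(ℝ, E) (𝓡 2) ∞ b V) {z : E} (hz : z ∈ V) (X Y : E) :
    ip (fderiv ℝ (F ∘ b) z X) (fderiv ℝ (F ∘ b) z Y) =
      g.inner (b z) (mfderiv 𝓘(ℝ, E) (𝓡 2) b z X) (mfderiv 𝓘(ℝ, E) (𝓡 2) b z Y) := by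
  rw [fderiv_comp_parameterization hF.smooth hV hb hz,
    fderiv_comp_parameterization hF.smooth hV hb hz, hF.isometric]

end Parameterizations

variable [IsManifold (𝓡 2) ∞ M] {g : LorentzianMetric M} {F : M → R22}

/-- A chart around `x`, sending `x` to `0`, in which the coordinate vectors at `0` are the null
vectors `w + v` and `w - v` of an orthonormal basis `v`, `w` of the tangent space. -/
theorem IsIsometricImmersion.exists_null_chart (hF : IsIsometricImmersion g F) (x : M) :
    ∃ c : OpenPartialHomeomorph M (ℝ × ℝ), x ∈ c.source ∧ c x = 0 ∧
      ContMDiffOn (𝓡 2) 𝓘(ℝ, ℝ × ℝ) ∞ c c.source ∧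
      ContMDiffOn 𝓘(ℝ, ℝ × ℝ) (𝓡 2) ∞ c.symm c.target ∧
      ip (fderiv ℝ (F ∘ c.symm) 0 (1, 0)) (fderiv ℝ (F ∘ c.symm) 0 (1, 0)) = 0 ∧
      0 < ip (fderiv ℝ (F ∘ c.symm) 0 (1, 0)) (fderiv ℝ (F ∘ c.symm) 0 (0, 1)) := by
  let k := chartAt (EuclideanSpace ℝ (Fin 2)) x
  have hx : x ∈ k.source := mem_chart_source _ x
  obtain ⟨v, w, hv, hw, hvw⟩ := g.signature x
  let v' : EuclideanSpace ℝ (Fin 2) := mfderiv (𝓡 2) (𝓡 2) k x v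
  let w' : EuclideanSpace ℝ (Fin 2) := mfderiv (𝓡 2) (𝓡 2) k x w
  have hk : k.MDifferentiable (𝓡 2) (𝓡 2) := mdifferentiable_chart x
  have hback : ∀ u : TangentSpace (𝓡 2) x,
      mfderiv (𝓡 2) (𝓡 2) k.symm (k x) (mfderiv (𝓡 2) (𝓡 2) k x u) = u := fun u =>
    DFunLike.congr_fun (hk.symm_comp_deriv hx) u
  have hsy : ContMDiffOn (𝓡 2) (𝓡 2) ∞ k.symm k.target := contMDiffOn_chart_symm
  let f : EuclideanSpace ℝ (Fin 2) → R22 := F ∘ k.symm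
  have hfd : ∀ u : TangentSpace (𝓡 2) x, fderiv ℝ f (k x) (mfderiv (𝓡 2) (𝓡 2) k x u) =
      mfderiv (𝓡 2) 𝓘(ℝ, R22) F x u := by
    intro u
    refine (fderiv_comp_parameterization hF.smooth k.open_target hsy (k.map_source hx) _).trans ?_
    rw [hback u, k.left_inv hx]
  have hv' : ip (fderiv ℝ f (k x) v') (fderiv ℝ f (k x) v') = -1 := by
    rw [hfd v, hF.isometric, hv]
  have hw' : ip (fderiv ℝ f (k x) w') (fderiv ℝ f (k x) w') = 1 := by
    rw [hfd w, hF.isometric, hw]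
  have hvw' : ip (fderiv ℝ f (k x) v') (fderiv ℝ f (k x) w') = 0 := by
    rw [hfd v, hfd w, hF.isometric, hvw]
  have hwv' := (ip_comm _ _).trans hvw'
  -- The chart `k` is composed with an affine map, whose linear part is inverse to `ℓ`.
  let ℓ : (ℝ × ℝ) →L[ℝ] EuclideanSpace ℝ (Fin 2) :=
    (ContinuousLinearMap.fst ℝ ℝ ℝ).smulRight (w' + v') +
      (ContinuousLinearMap.snd ℝ ℝ ℝ).smulRight (w' - v')
  have hℓ : ∀ y : ℝ × ℝ, ℓ y = y.1 • (w' + v') + y.2 • (w' - v') := fun y => rfl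
  have hℓip : ∀ y y' : ℝ × ℝ, ip (fderiv ℝ f (k x) (ℓ y)) (fderiv ℝ f (k x) (ℓ y')) =
      2 * (y.1 * y'.2 + y.2 * y'.1) := by
    intro y y'
    rw [hℓ, hℓ]
    simp only [sub_eq_add_neg, ← neg_one_smul ℝ v', map_add, map_smul, ip_add_left, ip_add_right,
      ip_smul_left, ip_smul_right, hv', hw', hvw', hwv']
    ring
  have hinj : Function.Injective ℓ := by
    rw [injective_iff_map_eq_zero]
    intro y hy
    have h1 := hℓip y (0, 1)
    have h2 := hℓip y (1, 0)
    have h3 : ∀ u : R22, ip 0 u = 0 := fun u => by simp [ip]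
    rw [hy, map_zero, h3] at h1 h2
    ext
    · simpa using h1.symm
    · simpa using h2.symm
  let L : (ℝ × ℝ) ≃L[ℝ] EuclideanSpace ℝ (Fin 2) :=
    (LinearEquiv.ofInjectiveOfFinrankEq (ℓ : (ℝ × ℝ) →ₗ[ℝ] EuclideanSpace ℝ (Fin 2)) hinj
      (by simp)).toContinuousLinearEquiv
  have hL : ∀ y, L y = ℓ y := fun y => rfl
  let A : EuclideanSpace ℝ (Fin 2) ≃ₜ ℝ × ℝ :=
    (Homeomorph.addRight (k x)).symm.trans L.symm.toHomeomorph
  have hAs : ∀ y, A.symm y = L y + k x := fun y => rfl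
  have hA : ∀ y, A y = L.symm (y + -k x) := fun y => rfl
  have hA0 : A.symm 0 = k x := by rw [hAs, map_zero, zero_add]
  have hAsd : HasFDerivAt A.symm (L : (ℝ × ℝ) →L[ℝ] EuclideanSpace ℝ (Fin 2)) 0 :=
    L.hasFDerivAt.add_const (k x)
  have hfA : ∀ y, fderiv ℝ (F ∘ (k.transHomeomorph A).symm) 0 y = fderiv ℝ f (k x) (ℓ y) := by
    intro y
    have h1 : HasFDerivAt f (fderiv ℝ f (k x)) (A.symm 0) := by
      rw [hA0]
      exact (contDiffOn_comp_parameterization hF.smooth hsy).hasFDerivAt k.open_target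
        (k.map_source hx)
    have h2 : HasFDerivAt (F ∘ (k.transHomeomorph A).symm) _ 0 := h1.comp 0 hAsd
    rw [h2.fderiv]; rfl
  have hAc : ContDiff ℝ ∞ A := L.symm.contDiff.comp (contDiff_id.add contDiff_const)
  have hAsc : ContDiff ℝ ∞ A.symm := L.contDiff.add contDiff_const
  refine ⟨k.transHomeomorph A, hx, ?_, ?_, ?_, ?_, ?_⟩
  · change A (k x) = 0
    rw [← hA0, A.apply_symm_apply]
  · exact hAc.contMDiff.comp_contMDiffOn contMDiffOn_chart
  · exact hsy.comp hAsc.contMDiff.contMDiffOn fun y hy => hy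
  · rw [hfA, hℓip]; simp
  · rw [hfA, hfA, hℓip]; norm_num

theorem IsIsometricImmersion.exists_conformalChart (hF : IsIsometricImmersion g F) (x : M) :
    ∃ (a : OpenPartialHomeomorph M LorentzNumber) (ρ : LorentzNumber → ℝ),
      x ∈ a.source ∧ NullConvex a.target ∧ (∀ z ∈ a.target, 0 < ρ z) ∧
        IsConformalChart g a ρ := by
  obtain ⟨c, hxc, hc0, hc, hcs, h11, h12⟩ := hF.exists_null_chart x
  obtain ⟨e, ρ, h0, hec, he, hes, hconv, hρ, hmet⟩ := exists_null_coordinates c.open_target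
    (hc0 ▸ c.map_source hxc) (contDiffOn_comp_parameterization hF.smooth hcs) h11 h12
  have ht : (c.trans e).target = e.target :=
    (c.trans_target e).trans (inter_eq_left.2 fun z hz => hec (e.map_target hz))
  have hs : ContMDiffOn 𝓘(ℝ, LorentzNumber) (𝓡 2) ∞ (c.trans e).symm (c.trans e).target := by
    rw [ht]
    exact hcs.comp hes.contMDiffOn fun z hz => hec (e.map_target hz)
  refine ⟨c.trans e, ρ, ?_, ht ▸ hconv, ht ▸ hρ, ?_, hs, ?_, ?_⟩
  · rw [c.trans_source]
    exact ⟨hxc, by rw [mem_preimage, hc0]; exact h0⟩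
  · rw [c.trans_source]
    exact he.contMDiffOn.comp (hc.mono inter_subset_left) fun z hz => hz.2
  · exact fun z hz => (hρ z (ht ▸ hz)).ne'
  · intro z hz X Y
    rw [← hF.ip_fderiv_comp (c.trans e).open_target hs hz]
    exact hmet z (ht ▸ hz) X Y

end Surfaces

end

theorem theorem1 :
    -- The direct statement.
    (∀ (φ₁ φ₂ ψ₁ ψ₂ : LorentzNumber → LorentzNumber) (p q : LorentzNumber → ℝ),
      Weierstrass.IsData Set.univ φ₁ φ₂ ψ₁ ψ₂ p q →
      ∀ z₀ : LorentzNumber,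
        (∀ c : R22, ∃! F : LorentzNumber → R22,
          F z₀ = c ∧ Weierstrass.IsIntegral Set.univ z₀ φ₁ φ₂ ψ₁ ψ₂ F) ∧
        ∀ F : LorentzNumber → R22, Weierstrass.IsIntegral Set.univ z₀ φ₁ φ₂ ψ₁ ψ₂ F →
          Weierstrass.HasGeometry Set.univ φ₁ φ₂ ψ₁ ψ₂ p q F) ∧
    -- The converse.
    (∀ (M : Type*) [TopologicalSpace M] [ChartedSpace (EuclideanSpace ℝ (Fin 2)) M]
      [IsManifold (modelWithCornersSelf ℝ (EuclideanSpace ℝ (Fin 2))) ∞ M]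
      [SimplyConnectedSpace M] (g : LorentzianMetric M) (F : M → R22),
      IsIsometricImmersion g F →
        (∀ x : M, ∃ (a : OpenPartialHomeomorph M LorentzNumber) (ρ : LorentzNumber → ℝ),
          x ∈ a.source ∧ LorentzNumber.NullConvex a.target ∧ (∀ z ∈ a.target, 0 < ρ z) ∧
          IsConformalChart g a ρ) ∧
        ∀ (a : OpenPartialHomeomorph M LorentzNumber) (ρ : LorentzNumber → ℝ),
          IsConformalChart g a ρ → LorentzNumber.NullConvex a.target →
          ∃ (φ₁ φ₂ ψ₁ ψ₂ : LorentzNumber → LorentzNumber) (p q : LorentzNumber → ℝ),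
            Weierstrass.IsData a.target φ₁ φ₂ ψ₁ ψ₂ p q ∧
            (∀ z₀ ∈ a.target,
              Weierstrass.IsIntegral a.target z₀ φ₁ φ₂ ψ₁ ψ₂ (F ∘ a.symm)) ∧
            (∀ z ∈ a.target, ρ z = Weierstrass.density φ₁ φ₂ ψ₁ ψ₂ z) ∧
            Weierstrass.HasGeometry a.target φ₁ φ₂ ψ₁ ψ₂ p q (F ∘ a.symm)) := by
  refine ⟨fun φ₁ φ₂ ψ₁ ψ₂ p q h z₀ => ?_, fun M _ _ _ _ g F hF =>
    ⟨hF.exists_conformalChart, fun a ρ ha hconv => ?_⟩⟩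
  · have hint := fun (F : LorentzNumber → R22)
        (hF : ∀ z, HasFDerivAt F (Weierstrass.spinorForm φ₁ φ₂ ψ₁ ψ₂ z) z) =>
      Weierstrass.isIntegral_of_hasFDerivAt h.smooth_φ₁ h.smooth_φ₂ h.smooth_ψ₁ h.smooth_ψ₂
        (fun z _ => hF z) z₀
    refine ⟨fun c => ?_, fun F hF => ?_⟩
    · obtain ⟨F, hF₀, hF⟩ := Weierstrass.exists_hasFDerivAt_spinorForm h z₀ c
      exact ⟨F, ⟨hF₀, hint F hF⟩, fun G hG => hG.2.eq_of_univ (hint F hF) (hG.1.trans hF₀.symm)⟩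
    · obtain ⟨G, hG₀, hG⟩ := Weierstrass.exists_hasFDerivAt_spinorForm h z₀ (F z₀)
      rw [hF.eq_of_univ (hint G hG) hG₀.symm]
      exact Weierstrass.hasGeometry_of_hasFDerivAt isOpen_univ h fun z _ => hG z
  · obtain ⟨φ₁, φ₂, ψ₁, ψ₂, p, q, h, hd, hρ⟩ := Weierstrass.exists_data a.open_target hconv
      (contDiffOn_comp_parameterization hF.smooth ha.smooth_symm) ha.ne_zero fun z hz X Y =>
        (hF.ip_fderiv_comp a.open_target ha.smooth_symm hz X Y).trans (ha.conformal z hz X Y)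
    exact ⟨φ₁, φ₂, ψ₁, ψ₂, p, q, h, fun z₀ _ => Weierstrass.isIntegral_of_hasFDerivAt h.smooth_φ₁
      h.smooth_φ₂ h.smooth_ψ₁ h.smooth_ψ₂ hd z₀, hρ,
      Weierstrass.hasGeometry_of_hasFDerivAt a.open_target h hd⟩
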